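/- Let $d\in\{2,3\}$, let $\Omega\subset\mathbb R^d$ be a bounded domain (open and connected) and $t_0<t_1$. Let $\kappa\in L^\infty(\Omega)$ with $\kappa\ge\kappa_{\min}>0$ a.e., $\alpha\in L^\infty(\Omega)$, $Re>0$, sources $g_T\in L^2(t_0,t_1;L^2(\Omega))$ and $g_u\in L^2(\Omega)^d$, and boundary data given by extensions $T_b\in L^2(t_0,t_1;H^1(\Omega))$ with weak time derivative in $L^2(t_0,t_1;L^2(\Omega))$, and $u_b\in H^1(\Omega)^d\cap L^4(\Omega)^d$. For an initial temperature $\pi\in H^1(\Omega)$, the CFD model for $(T_e,u,p)\in L^2(t_0,t_1;H^1(\Omega))\times H^1(\Omega)^d\times L^2(\Omega)$ is, in the weak sense, $$\frac{\partial T_e}{\partial t}-\nabla\cdot(\kappa\nabla T_e)+u\cdot\nabla T_e=g_T\ \text{ in }\Omega\times(t_0,t_1),\qquad T_e=T_b\ \text{ on }\partial\Omega,\qquad T_e(\cdot,t_0)=\pi,$$ $$-\frac1{Re}\Delta u+u\cdot\nabla u+\nabla p+\alpha u=g_u,\qquad \nabla\cdot u=0\ \text{ in }\Omega,\qquad u=u_b\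 \text{ on }\partial\Omega,\qquad \int_\Omega p=0 .$$ Boundary conditions are understood as $T_e(t)-T_b(t)\in H^1_0(\Omega)$ for a.e. $t$, and $u-u_b\in H^1_0(\Omega)^d$. The temperature equation with its initial condition means that, for all $\varphi\in C_c^\infty(\Omega)$ and $\psi\in C_c^\infty((-\infty,t_1))$, $$-\int_{t_0}^{t_1}\psi'\langle T_e,\varphi\rangle\,dt+\int_{t_0}^{t_1}\psi\,\bigl(\langle\kappa\nabla T_e,\nabla\varphi\rangle+\langle u\cdot\nabla T_e,\varphi\rangle\bigr)\,dt=\int_{t_0}^{t_1}\psi\langle g_T,\varphi\rangle\,dt+\psi(t_0)\langle\pi,\varphi\rangle .$$ Let $(u,p)$ be a weak solution of the flow equations (the second line). Then there is a map $S:H^1(\Omega)\to L^2(t_0,t_1;H^1(\Omega))\times H^1(\Omega)^d\times L^2(\Omega)$ such that: 1. for every $\pi\in H^1(\Omega)$, $S(\pi)$ is the unique solution of the CFD model with initial temperature $\pi$ and velocity $u$; if $u$ is the only velocity solving the flow equations, then $S(\pi)$ is the unique solution of the CFD model with initial temperature $\pi$; 2. for every $\pi_0\in H^1(\Omega)$ and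 every direction $\delta\pi_0\in H^1(\Omega)$, the Gateaux derivative $$\lim_{s\to0}\frac{S(\pi_0+s\,\delta\pi_0)-S(\pi_0)}{s}$$ exists in the norm of $L^2(t_0,t_1;H^1(\Omega))\times H^1(\Omega)^d\times L^2(\Omega)$ and equals $(w_t,0,0)$: the derivatives of velocity and pressure are zero, and $w_t\in L^2(t_0,t_1;H^1(\Omega))$ is the unique weak solution of $$\frac{\partial w_t}{\partial t}-\nabla\cdot(\kappa\nabla w_t)+u\cdot\nabla w_t=0\ \text{ in }\Omega\times(t_0,t_1),\qquad w_t=0\ \text{ on }\partial\Omega,\qquad w_t(\cdot,t_0)=\delta\pi_0,$$ where $u$ is the velocity component of $S(\pi_0)$. -/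

import Mathlib

open MeasureTheory Set Filter
open scoped ContDiff ENNReal

noncomputable section

namespace CFD

/-- Points of `d`-dimensional Euclidean space. -/
abbrev Pt (d : ℕ) : Type := EuclideanSpace ℝ (Fin d)

/-- Lebesgue measure on `Ω`. -/
abbrev vol {d : ℕ} (Ω : Set (Pt d)) : Measure (Pt d) := volume.restrict Ω

/-- Lebesgue measure on the time interval `(t₀, t₁)`. -/
abbrev tvol (t₀ t₁ : ℝ) : Measure ℝ := volume.restrict (Ioo t₀ t₁)

/-- `C_c^∞(Ω)`: smooth real functions with compact support contained in `Ω`. -/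
def IsTest {V : Type*} [NormedAddCommGroup V] [NormedSpace ℝ V] (Ω : Set V) (φ : V → ℝ) : Prop :=
  ContDiff ℝ ∞ φ ∧ HasCompactSupport φ ∧ tsupport φ ⊆ Ω

/-- The classical partial derivative `∂φ/∂x_i`. -/
def pd {d : ℕ} (i : Fin d) (φ : Pt d → ℝ) (x : Pt d) : ℝ :=
  fderiv ℝ φ x (EuclideanSpace.single i 1)

lemma IsTest.memLp {d : ℕ} {Ω : Set (Pt d)} {φ : Pt d → ℝ} (h : IsTest Ω φ) :
    MemLp φ 2 (vol Ω) :=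
  h.1.continuous.memLp_of_hasCompactSupport h.2.1

lemma IsTest.memLp_pd {d : ℕ} {Ω : Set (Pt d)} {φ : Pt d → ℝ} (h : IsTest Ω φ) (i : Fin d) :
    MemLp (pd i φ) 2 (vol Ω) :=
  Continuous.memLp_of_hasCompactSupport
    ((h.1.continuous_fderiv (by simp)).clm_apply continuous_const)
    (h.2.1.fderiv_apply (𝕜 := ℝ) _)

lemma IsTest.add {d : ℕ} {Ω : Set (Pt d)} {φ ψ : Pt d → ℝ} (h : IsTest Ω φ) (k : IsTest Ω ψ) :
    IsTest Ω (fun x => φ x + ψ x) :=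
  ⟨h.1.add k.1, h.2.1.add k.2.1, (tsupport_add φ ψ).trans (union_subset h.2.2 k.2.2)⟩

lemma IsTest.smul {d : ℕ} {Ω : Set (Pt d)} {φ : Pt d → ℝ} (c : ℝ) (h : IsTest Ω φ) :
    IsTest Ω (fun x => c * φ x) :=
  ⟨contDiff_const.mul h.1, h.2.1.mul_left,
    (closure_mono (Function.support_mul_subset_right _ _)).trans h.2.2⟩

lemma IsTest.zero {d : ℕ} {Ω : Set (Pt d)} : IsTest Ω (fun _ => (0 : ℝ)) :=
  ⟨contDiff_const, HasCompactSupport.zero, by simp [tsupport]⟩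

/-- `g` is the weak gradient in `Ω` of `v`:
`∫_Ω v ∂_i φ = - ∫_Ω g_i φ` for all `φ ∈ C_c^∞(Ω)` and all `i`. -/
def IsWeakGrad {d : ℕ} (Ω : Set (Pt d)) (v : Lp ℝ 2 (vol Ω)) (g : Lp (Pt d) 2 (vol Ω)) : Prop :=
  ∀ (i : Fin d) (φ : Pt d → ℝ), IsTest Ω φ →
    ∫ x in Ω, v x * pd i φ x = - ∫ x in Ω, g x i * φ x

lemma memLp_coord {d : ℕ} {Ω : Set (Pt d)} (g : Lp (Pt d) 2 (vol Ω)) (i : Fin d) :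
    MemLp (fun x => g x i) 2 (vol Ω) :=
  (EuclideanSpace.proj (𝕜 := ℝ) i : Pt d →L[ℝ] ℝ).comp_memLp' (Lp.memLp g)

/-- The Sobolev space `H¹(Ω)`, as the space of pairs `(v, ∇v)` in `L²(Ω) × L²(Ω; ℝ^d)`, with the
norm `(‖v‖² + ‖∇v‖²)^{1/2}`. (The weak gradient of `v` is unique when `Ω` is open.) -/
def H1 {d : ℕ} (Ω : Set (Pt d)) :
    Submodule ℝ (WithLp 2 (Lp ℝ 2 (vol Ω) × Lp (Pt d) 2 (vol Ω))) where
  carrier := {z | IsWeakGrad Ω z.fst z.snd}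
  zero_mem' := by
    intro i φ _
    have h1 : ∫ x in Ω, (0 : Lp ℝ 2 (vol Ω)) x * pd i φ x = 0 := by
      rw [integral_eq_zero_of_ae]
      filter_upwards [Lp.coeFn_zero ℝ 2 (vol Ω)] with x hx
      rw [hx]; simp
    have h2 : ∫ x in Ω, (0 : Lp (Pt d) 2 (vol Ω)) x i * φ x = 0 := by
      rw [integral_eq_zero_of_ae]
      filter_upwards [Lp.coeFn_zero (Pt d) 2 (vol Ω)] with x hx
      rw [hx]; simp
    simp only [WithLp.zero_fst, WithLp.zero_snd]
    rw [h1, h2, neg_zero]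
  add_mem' := by
    intro a b ha hb i φ hφ
    have h1 : ∫ x in Ω, (a.fst + b.fst : Lp ℝ 2 (vol Ω)) x * pd i φ x
        = (∫ x in Ω, a.fst x * pd i φ x) + ∫ x in Ω, b.fst x * pd i φ x := by
      refine Eq.trans ?_ (integral_add ((Lp.memLp a.fst).integrable_mul (hφ.memLp_pd i))
        ((Lp.memLp b.fst).integrable_mul (hφ.memLp_pd i)))
      refine integral_congr_ae ?_
      filter_upwards [Lp.coeFn_add a.fst b.fst] with x hx
      rw [hx]; simp [add_mul]
    have h2 : ∫ x in Ω, (a.snd + b.snd : Lp (Pt d) 2 (vol Ω)) x i * φ x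
        = (∫ x in Ω, a.snd x i * φ x) + ∫ x in Ω, b.snd x i * φ x := by
      refine Eq.trans ?_ (integral_add ((memLp_coord a.snd i).integrable_mul hφ.memLp)
        ((memLp_coord b.snd i).integrable_mul hφ.memLp))
      refine integral_congr_ae ?_
      filter_upwards [Lp.coeFn_add a.snd b.snd] with x hx
      rw [hx]; simp [add_mul]
    simp only [WithLp.add_fst, WithLp.add_snd]
    rw [h1, h2, ha i φ hφ, hb i φ hφ]
    ring
  smul_mem' := by
    intro c a ha i φ hφ
    have h1 : ∫ x in Ω, (c • a.fst : Lp ℝ 2 (vol Ω)) x * pd i φ x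
        = c * ∫ x in Ω, a.fst x * pd i φ x := by
      rw [← integral_const_mul]
      refine integral_congr_ae ?_
      filter_upwards [Lp.coeFn_smul c a.fst] with x hx
      rw [hx]; simp [mul_assoc]
    have h2 : ∫ x in Ω, (c • a.snd : Lp (Pt d) 2 (vol Ω)) x i * φ x
        = c * ∫ x in Ω, a.snd x i * φ x := by
      rw [← integral_const_mul]
      refine integral_congr_ae ?_
      filter_upwards [Lp.coeFn_smul c a.snd] with x hx
      rw [hx]; simp [mul_assoc]
    simp only [WithLp.smul_fst, WithLp.smul_snd]
    rw [h1, h2, ha i φ hφ]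
    ring

/-- The underlying `L²` function of an element of `H¹(Ω)`. -/
def val {d : ℕ} {Ω : Set (Pt d)} (v : H1 Ω) : Lp ℝ 2 (vol Ω) := v.1.fst

/-- The weak gradient of an element of `H¹(Ω)`. -/
def grad {d : ℕ} {Ω : Set (Pt d)} (v : H1 Ω) : Lp (Pt d) 2 (vol Ω) := v.1.snd

/-- The subspace of `H¹(Ω)` of the (classes of) functions in `C_c^∞(Ω)`. -/
def testH1 {d : ℕ} (Ω : Set (Pt d)) : Submodule ℝ (H1 Ω) where
  carrier := {v | ∃ φ : Pt d → ℝ, IsTest Ω φ ∧ val v =ᵐ[vol Ω] φ}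
  zero_mem' := ⟨fun _ => 0, IsTest.zero, Lp.coeFn_zero ℝ 2 (vol Ω)⟩
  add_mem' := by
    rintro a b ⟨φ, hφ, ha⟩ ⟨ψ, hψ, hb⟩
    refine ⟨_, hφ.add hψ, ?_⟩
    filter_upwards [Lp.coeFn_add (val a) (val b), ha, hb] with x hx h1 h2
    have : val (a + b) = val a + val b := rfl
    rw [this, hx, Pi.add_apply, h1, h2]
  smul_mem' := by
    rintro c a ⟨φ, hφ, ha⟩
    refine ⟨_, hφ.smul c, ?_⟩
    filter_upwards [Lp.coeFn_smul c (val a), ha] with x hx h1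
    have : val (c • a) = c • val a := rfl
    rw [this, hx, Pi.smul_apply, h1, smul_eq_mul]

/-- `H¹₀(Ω)`, the closure of `C_c^∞(Ω)` in `H¹(Ω)`: the functions with zero boundary values. -/
def H10 {d : ℕ} (Ω : Set (Pt d)) : Submodule ℝ (H1 Ω) := (testH1 Ω).topologicalClosure

/-- Temperature fields: `L²(t₀, t₁; H¹(Ω))`. -/
abbrev Temp {d : ℕ} (Ω : Set (Pt d)) (t₀ t₁ : ℝ) : Type := Lp (H1 Ω) 2 (tvol t₀ t₁)

/-- Velocity fields: `H¹(Ω)^d`. -/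
abbrev Vel {d : ℕ} (Ω : Set (Pt d)) : Type := PiLp 2 (fun _ : Fin d => H1 Ω)

/-- Pressure fields: `L²(Ω)`. -/
abbrev Pres {d : ℕ} (Ω : Set (Pt d)) : Type := Lp ℝ 2 (vol Ω)

/-- States `(T_e, u, p)`, in `L²(t₀, t₁; H¹(Ω)) × H¹(Ω)^d × L²(Ω)`. -/
abbrev State {d : ℕ} (Ω : Set (Pt d)) (t₀ t₁ : ℝ) : Type := Temp Ω t₀ t₁ × Vel Ω × Pres Ω

/-- `(u · ∇v)(x)`. -/
def advect {d : ℕ} {Ω : Set (Pt d)} (u : Vel Ω) (v : H1 Ω) (x : Pt d) : ℝ :=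
  ∑ j, val (u j) x * grad v x j

/-- `G'` is the weak derivative on `(t₀, t₁)` of `t ↦ G t`, as a function with values in `L²(Ω)`:
`∫ ψ'(t) G(t) dt = - ∫ ψ(t) G'(t) dt` for `ψ ∈ C_c^∞((t₀, t₁))`. -/
def IsWeakTimeDeriv {d : ℕ} {Ω : Set (Pt d)} {t₀ t₁ : ℝ} (G : Temp Ω t₀ t₁)
    (G' : Lp (Lp ℝ 2 (vol Ω)) 2 (tvol t₀ t₁)) : Prop :=
  ∀ ψ : ℝ → ℝ, IsTest (Ioo t₀ t₁) ψ →
    ∫ t in Ioo t₀ t₁, deriv ψ t • val (G t) = - ∫ t in Ioo t₀ t₁, ψ t • G' t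

/-- `T` is a weak solution, in `L²(t₀, t₁; H¹(Ω))`, of
`∂T/∂t - ∇ · (κ ∇T) + u · ∇T = g` in `Ω × (t₀, t₁)`, `T = Tb` on `∂Ω × (t₀, t₁)`, `T(t₀) = π`:
for every `φ ∈ C_c^∞(Ω)`, the identity `d/dt ⟨T, φ⟩ + ⟨κ ∇T, ∇φ⟩ + ⟨u · ∇T, φ⟩ = ⟨g, φ⟩` holds in
the sense of distributions on `[t₀, t₁)` with `⟨T(t₀), φ⟩ = ⟨π, φ⟩`. The time test functions `ψ`
vanish near `t₁` but not at `t₀`; the term with `ψ t₀` is the initial condition. -/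
def IsTemperature {d : ℕ} {Ω : Set (Pt d)} {t₀ t₁ : ℝ} (κ : Pt d → ℝ) (u : Vel Ω)
    (g : Lp (Lp ℝ 2 (vol Ω)) 2 (tvol t₀ t₁)) (Tb : Temp Ω t₀ t₁) (π : H1 Ω)
    (T : Temp Ω t₀ t₁) : Prop :=
  (∀ᵐ t ∂(tvol t₀ t₁), T t - Tb t ∈ H10 Ω) ∧
  ∀ (φ : Pt d → ℝ) (ψ : ℝ → ℝ), IsTest Ω φ → IsTest (Iio t₁) ψ →
    - (∫ t in Ioo t₀ t₁, deriv ψ t * ∫ x in Ω, val (T t) x * φ x)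
      + (∫ t in Ioo t₀ t₁, ψ t * ∫ x in Ω, κ x * ∑ j, grad (T t) x j * pd j φ x)
      + (∫ t in Ioo t₀ t₁, ψ t * ∫ x in Ω, advect u (T t) x * φ x)
    = (∫ t in Ioo t₀ t₁, ψ t * ∫ x in Ω, g t x * φ x) + ψ t₀ * ∫ x in Ω, val π x * φ x

/-- The data of the model other than the initial temperature. -/
structure Data {d : ℕ} (Ω : Set (Pt d)) (t₀ t₁ : ℝ) where
  /-- thermal diffusivity -/
  κ : Pt d → ℝ
  /-- friction coefficient -/
  α : Pt d → ℝ
  /-- Reynolds number -/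
  Re : ℝ
  /-- heat source -/
  gT : Lp (Lp ℝ 2 (vol Ω)) 2 (tvol t₀ t₁)
  /-- flow source -/
  gu : Lp (Pt d) 2 (vol Ω)
  /-- boundary temperature, given by an extension to `Ω × (t₀, t₁)` -/
  Tb : Temp Ω t₀ t₁
  /-- boundary velocity, given by an extension to `Ω` -/
  ub : Vel Ω

/-- Admissible data: `κ` is bounded and bounded below by a positive constant, `α` is bounded,
`Re > 0`, the boundary temperature has a weak time derivative in `L²(t₀, t₁; L²(Ω))`, the boundary
velocity is in `L⁴(Ω)`. -/
structure Data.Admissible {d : ℕ} {Ω : Set (Pt d)} {t₀ t₁ : ℝ} (D : Data Ω t₀ t₁) : Prop where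
  κ_bdd : MemLp D.κ ∞ (vol Ω)
  κ_pos : ∃ c : ℝ, 0 < c ∧ ∀ᵐ x ∂(vol Ω), c ≤ D.κ x
  α_bdd : MemLp D.α ∞ (vol Ω)
  Re_pos : 0 < D.Re
  Tb_deriv : ∃ G', IsWeakTimeDeriv D.Tb G'
  ub_L4 : ∀ i, MemLp (val (D.ub i)) 4 (vol Ω)

/-- `(u, p)` is a weak solution of the stationary Navier–Stokes equations
`- (1/Re) Δu + u · ∇u + ∇p + α u = g_u`, `∇ · u = 0` in `Ω`, `u = u_b` on `∂Ω`,
the pressure being normalised by `∫_Ω p = 0`. -/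
def IsFlow {d : ℕ} {Ω : Set (Pt d)} {t₀ t₁ : ℝ} (D : Data Ω t₀ t₁) (u : Vel Ω) (p : Pres Ω) :
    Prop :=
  (∀ i, u i - D.ub i ∈ H10 Ω) ∧
  (∀ᵐ x ∂(vol Ω), ∑ i, grad (u i) x i = 0) ∧
  (∫ x in Ω, p x = 0) ∧
  ∀ (i : Fin d) (φ : Pt d → ℝ), IsTest Ω φ →
    (∫ x in Ω, D.α x * val (u i) x * φ x)
      + (1 / D.Re) * (∫ x in Ω, ∑ j, grad (u i) x j * pd j φ x)
      + (∫ x in Ω, advect u (u i) x * φ x)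
      - (∫ x in Ω, p x * pd i φ x)
    = ∫ x in Ω, D.gu x i * φ x

/-- `z = (T_e, u, p)` is a solution of the CFD model with initial temperature `π`. -/
def IsCFDSolution {d : ℕ} {Ω : Set (Pt d)} {t₀ t₁ : ℝ} (D : Data Ω t₀ t₁) (π : H1 Ω)
    (z : State Ω t₀ t₁) : Prop :=
  IsFlow D z.2.1 z.2.2 ∧ IsTemperature D.κ z.2.1 D.gT D.Tb π z.1

end CFD

end

/-! The flow equations do not involve the temperature, so with the velocity `u` prescribed the only
component that reacts to the initial value `π` is the temperature, and it solves a linear problem.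
Hence `T (π + s • δ) = T π + s • W δ`, where `W δ` solves the same problem with zero source and zero
boundary values. The difference quotient does not depend on `s`, and the Gateaux derivative is `(W
δ, 0, 0)`. The work lies in the well-posedness of the temperature equation and the uniqueness of the
pressure.

Coercivity on `H¹₀`. Diffusion is coercive by the Poincaré inequality (`exists_diffusion`).
Advection contributes nothing to the energy because `u` is divergence free (`integral_advect_self`).
It defines a bounded form because Sobolev's inequality, for `d` equal to 2 or 3, puts both `u` and
the test function in `L⁴` (`exists_advection`).

Existence. The boundary extension is subtracted, and Lions' representation lemma solves the
remaining problem in a Hilbert space (`exists_parabolic`, `exists_isWeakSol`). The time derivative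
of the extension supplies the initial trace that has to be subtracted as well
(`exists_initial_trace`).

Uniqueness. No time regularity of a solution is assumed, so the equation is integrated in time
before it is tested: with `W` the primitive of `v` it reads `B v + A W = 0`, where `B` is `ι† ι`.
Pairing with `W` and using `integral_inner_primitive_nonneg` gives `W = 0`, hence `v = 0`
(`eq_zero_of_parabolic`).

Pressure. Two pressures for one velocity differ by a function with zero weak gradient, which is
constant on a connected set, and the normalisation of the mean makes it zero
(`IsFlow.pressure_unique`). -/

namespace CFD
open scoped Topology RealInnerProductSpace

/-! ### Hilbert space lemmas and vector-valued calculus on an interval -/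

section Abstract

/-- Lions' representation lemma. -/
theorem exists_forall_inner_eq {Φ X : Type*} [AddCommGroup Φ] [Module ℝ Φ]
    [NormedAddCommGroup X] [InnerProductSpace ℝ X] [CompleteSpace X]
    (K : Φ →ₗ[ℝ] X) (L : Φ →ₗ[ℝ] ℝ) (C : ℝ) (h : ∀ f, |L f| ≤ C * ‖K f‖) :
    ∃ v : X, ∀ f, ⟪v, K f⟫ = L f := by
  obtain ⟨g, hg⟩ := K.rangeRestrict.exists_rightInverse_of_surjective K.range_rangeRestrict
  have hg' : ∀ x, K (g x) = x := fun x => congrArg Subtype.val (LinearMap.congr_fun hg x)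
  obtain ⟨l, hl, -⟩ := exists_extension_norm_eq (LinearMap.range K)
    ((L ∘ₗ g).mkContinuous C fun x => by simpa [hg'] using h (g x))
  refine ⟨(InnerProductSpace.toDual ℝ X).symm l, fun f => ?_⟩
  have h1 := hl (K.rangeRestrict f)
  rw [InnerProductSpace.toDual_symm_apply]
  -- `L` vanishes on the kernel of `K`, so the choice of the linear section `g` does not matter: `L`
  -- factors through the range of `K`, where Hahn–Banach and Riesz apply.
  have h2 := h (g (K.rangeRestrict f) - f)
  rw [map_sub K, hg', show ((K.rangeRestrict f : LinearMap.range K) : X) = K f from rfl, sub_self,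
    norm_zero, mul_zero] at h2
  have h3 := abs_nonpos_iff.1 h2
  rw [map_sub] at h3
  simp at h1
  linarith

variable {t₀ t₁ : ℝ}

/-- Integration by parts against a primitive. -/
theorem integral_smul_eq_neg_integral_deriv_smul_primitive {E : Type*} [NormedAddCommGroup E]
    [InnerProductSpace ℝ E] [CompleteSpace E] (ht : t₀ ≤ t₁) {x : ℝ → E}
    (hx : IntegrableOn x (Ioo t₀ t₁)) {ψ : ℝ → ℝ} (hψ : ContDiff ℝ 1 ψ) (h1 : ψ t₁ = 0) :
    ∫ t in Ioo t₀ t₁, ψ t • x t = - ∫ t in Ioo t₀ t₁, deriv ψ t • ∫ s in t₀..t, x s := by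
  have hxi : IntervalIntegrable x volume t₀ t₁ := by
    rwa [intervalIntegrable_iff_integrableOn_Ioo_of_le ht]
  have hψc : ContinuousOn ψ (uIcc t₀ t₁) := hψ.continuous.continuousOn
  have hdc : Continuous (deriv ψ) := hψ.continuous_deriv le_rfl
  have hXc : ContinuousOn (fun t => ∫ s in t₀..t, x s) (uIcc t₀ t₁) :=
    intervalIntegral.continuousOn_primitive_interval' hxi left_mem_uIcc
  rw [← integral_Ioc_eq_integral_Ioo, ← integral_Ioc_eq_integral_Ioo,
    ← intervalIntegral.integral_of_le ht, ← intervalIntegral.integral_of_le ht]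
  -- Pairing with a fixed `z` reduces to scalar functions. There the primitive is absolutely
  -- continuous, and both boundary terms vanish: `ψ` at `t₁`, the primitive at `t₀`.
  refine ext_inner_left ℝ fun z => ?_
  have hzi : IntervalIntegrable (fun t => ⟪z, x t⟫) volume t₀ t₁ :=
    ⟨hxi.1.const_inner z, hxi.2.const_inner z⟩
  have key : ∀ y : ℝ → E, IntervalIntegrable y volume t₀ t₁ →
      ⟪z, ∫ t in t₀..t₁, y t⟫ = ∫ t in t₀..t₁, ⟪z, y t⟫ := fun y hy =>
    ((innerSL ℝ z).intervalIntegral_comp_comm hy).symm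
  rw [inner_neg_right, key _ (hxi.continuousOn_smul hψc),
    key (fun t => deriv ψ t • ∫ s in t₀..t, x s)
      ((hdc.continuousOn.smul hXc).intervalIntegrable)]
  simp only [inner_smul_right]
  have hX : ∀ t ∈ uIcc t₀ t₁, ⟪z, ∫ s in t₀..t, x s⟫ = ∫ s in t₀..t, ⟪z, x s⟫ := fun t h =>
    ((innerSL ℝ z).intervalIntegral_comp_comm
      (hxi.mono_set (uIcc_subset_uIcc left_mem_uIcc h))).symm
  have hac := hzi.absolutelyContinuousOnInterval_intervalIntegral (c := t₀) left_mem_uIcc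
  have hψac : AbsolutelyContinuousOnInterval ψ t₀ t₁ :=
    hψ.contDiffOn.absolutelyContinuousOnInterval
  have := hψac.integral_mul_deriv_eq_deriv_mul hac
  rw [h1] at this
  simp only [zero_mul, intervalIntegral.integral_same, mul_zero, sub_zero, zero_sub] at this
  rw [intervalIntegral.integral_congr (fun t h => congrArg (deriv ψ t * ·) (hX t h))]
  rw [← this]
  refine intervalIntegral.integral_congr_ae ?_
  filter_upwards [hzi.ae_hasDerivAt_integral] with t h h'
  rw [(h (uIoc_subset_uIcc h') t₀ left_mem_uIcc).deriv]

/-- The primitive vanishes to the left of the hull of the support of `χ`, and also to its right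
because the total integral is zero. This supplies the test functions for the du Bois-Reymond lemma.
-/
theorem IsTest.primitive {χ : ℝ → ℝ} (hχ : IsTest (Ioo t₀ t₁) χ) (h0 : ∫ t, χ t = 0) :
    ∃ ψ, IsTest (Ioo t₀ t₁) ψ ∧ deriv ψ = χ := by
  have hi : ∀ a b, IntervalIntegrable χ volume a b := fun a b =>
    hχ.1.continuous.intervalIntegrable a b
  have hd : ∀ t, HasDerivAt (fun t => ∫ s in t₀..t, χ s) (χ t) t := fun t =>
    intervalIntegral.integral_hasDerivAt_right (hi _ _)
      hχ.1.continuous.aestronglyMeasurable.stronglyMeasurableAtFilter hχ.1.continuous.continuousAt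
  have hd' : deriv (fun t => ∫ s in t₀..t, χ s) = χ := funext fun t => (hd t).deriv
  rcases (tsupport χ).eq_empty_or_nonempty with he | hne
  · rw [tsupport_eq_empty_iff] at he
    subst he
    exact ⟨fun _ => 0, ⟨contDiff_const, HasCompactSupport.zero, by simp [tsupport]⟩, by ext; simp⟩
  have hK : IsCompact (tsupport χ) := hχ.2.1
  set a := sInf (tsupport χ)
  set b := sSup (tsupport χ)
  have ha : a ∈ Ioo t₀ t₁ := hχ.2.2 (hK.sInf_mem hne)
  have hb : b ∈ Ioo t₀ t₁ := hχ.2.2 (hK.sSup_mem hne)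
  have hzero : ∀ t, t ∉ Icc a b → χ t = 0 := fun t h => by
    by_contra h'
    have := subset_tsupport χ h'
    exact h ⟨csInf_le hK.bddBelow this, le_csSup hK.bddAbove this⟩
  have hsupp : Function.support (fun t => ∫ s in t₀..t, χ s) ⊆ Icc a b := by
    intro t h
    by_contra h'
    apply h
    rcases lt_or_ge t a with hta | hta
    · refine (intervalIntegral.integral_congr (g := fun _ => 0) fun s hs => hzero s ?_).trans
        (by simp)
      intro hs'
      have := hs.2
      have : s ≤ max t₀ t := this
      have : max t₀ t < a := max_lt ha.1 hta
      linarith [hs'.1]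
    · have htb : b < t := by
        by_contra hc
        exact h' ⟨hta, not_lt.1 hc⟩
      show ∫ s in t₀..t, χ s = 0
      rw [intervalIntegral.integral_of_le (by linarith [hb.1]), ← h0]
      refine setIntegral_eq_integral_of_forall_compl_eq_zero fun s hs => hzero s fun hs' => hs ?_
      exact ⟨ha.1.trans_le hs'.1, hs'.2.trans htb.le⟩
  refine ⟨fun t => ∫ s in t₀..t, χ s, ⟨?_, ?_, ?_⟩, hd'⟩
  · rw [contDiff_infty_iff_deriv]
    exact ⟨fun t => (hd t).differentiableAt, hd'.symm ▸ hχ.1⟩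
  · exact HasCompactSupport.intro isCompact_Icc fun t h => by
      by_contra h'; exact h (hsupp h')
  · exact (closure_minimal hsupp isClosed_Icc).trans fun t h =>
      ⟨ha.1.trans_le h.1, h.2.trans_lt hb.2⟩

theorem IsTest.deriv {s : Set ℝ} {ψ : ℝ → ℝ} (h : IsTest s ψ) : IsTest s (deriv ψ) :=
  ⟨(contDiff_infty_iff_deriv.1 h.1).2, h.2.1.deriv,
    (closure_minimal (support_deriv_subset) isClosed_closure).trans h.2.2⟩

theorem IsTest.mono {V : Type*} [NormedAddCommGroup V] [NormedSpace ℝ V] {s t : Set V}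
    {ψ : V → ℝ} (h : IsTest s ψ) (hst : s ⊆ t) : IsTest t ψ :=
  ⟨h.1, h.2.1, h.2.2.trans hst⟩

theorem IsTest.add_mul {V : Type*} [NormedAddCommGroup V] [NormedSpace ℝ V] {s : Set V}
    {φ ψ : V → ℝ} (h : IsTest s φ) (k : IsTest s ψ) (c : ℝ) : IsTest s (fun x => φ x + c * ψ x) :=
  ⟨h.1.add (contDiff_const.mul k.1), h.2.1.add k.2.1.mul_left,
    (tsupport_add φ _).trans (union_subset h.2.2
      ((closure_mono (Function.support_mul_subset_right _ _)).trans k.2.2))⟩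

theorem IsTest.eq_zero {V : Type*} [NormedAddCommGroup V] [NormedSpace ℝ V] {s : Set V}
    {ψ : V → ℝ} (h : IsTest s ψ) {x : V} (hx : x ∉ s) : ψ x = 0 :=
  image_eq_zero_of_notMem_tsupport fun h' => hx (h.2.2 h')

theorem integrableOn_continuous_smul {E : Type*} [NormedAddCommGroup E] [NormedSpace ℝ E]
    {y : ℝ → E} (hy : IntegrableOn y (Ioo t₀ t₁)) {χ : ℝ → ℝ} (hχ : Continuous χ) :
    IntegrableOn (fun t => χ t • y t) (Ioo t₀ t₁) := by
  rw [← integrableOn_Icc_iff_integrableOn_Ioo] at hy ⊢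
  exact hy.continuousOn_smul hχ.continuousOn isCompact_Icc

theorem IsTest.setIntegral_eq {E : Type*} [NormedAddCommGroup E] [NormedSpace ℝ E] {V : Type*}
    [NormedAddCommGroup V] [NormedSpace ℝ V] [MeasureSpace V] {s : Set V}
    {χ : V → ℝ} (hχ : IsTest s χ) (y : V → E) :
    ∫ t in s, χ t • y t = ∫ t, χ t • y t :=
  setIntegral_eq_integral_of_forall_compl_eq_zero fun t ht => by rw [hχ.eq_zero ht, zero_smul]

/-- The lemma of du Bois-Reymond. -/
theorem exists_ae_eq_const_of_forall_integral_deriv_smul {E : Type*} [NormedAddCommGroup E]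
    [NormedSpace ℝ E] [CompleteSpace E] (ht : t₀ < t₁) {y : ℝ → E}
    (hy : IntegrableOn y (Ioo t₀ t₁))
    (h : ∀ ψ, IsTest (Ioo t₀ t₁) ψ → ∫ t in Ioo t₀ t₁, deriv ψ t • y t = 0) :
    ∃ c : E, ∀ᵐ t ∂(tvol t₀ t₁), y t = c := by
  obtain ⟨ρ, hρ, hρ1⟩ : ∃ ρ : ℝ → ℝ, IsTest (Ioo t₀ t₁) ρ ∧ ∫ t, ρ t = 1 := by
    obtain ⟨f, hf⟩ : ∃ f : ContDiffBump ((t₀ + t₁) / 2), f.rOut = (t₁ - t₀) / 4 :=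
      ⟨⟨(t₁ - t₀) / 8, (t₁ - t₀) / 4, by linarith, by linarith⟩, rfl⟩
    refine ⟨f.normed volume, ⟨f.contDiff_normed, f.hasCompactSupport_normed, ?_⟩,
      f.integral_normed⟩
    rw [f.tsupport_normed_eq, hf, Real.closedBall_eq_Icc]
    exact fun t h => ⟨by linarith [h.1], by linarith [h.2]⟩
  -- The constant is the mean of `y` with weight `ρ`. For any test function `χ` of integral `m`, `χ
  -- - m ρ` has mean zero, hence is an admissible derivative, and this gives `∫ χ • (y - c) = 0`.
  set c := ∫ t in Ioo t₀ t₁, ρ t • y t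
  refine ⟨c, ?_⟩
  rw [ae_restrict_iff' measurableSet_Ioo]
  have hyc : IntegrableOn (fun t => y t - c) (Ioo t₀ t₁) :=
    hy.sub (integrableOn_const (by simp))
  have := isOpen_Ioo.ae_eq_zero_of_integral_contDiff_smul_eq_zero (f := fun t => y t - c)
    (μ := volume) (U := Ioo t₀ t₁) hyc.locallyIntegrableOn ?_
  · filter_upwards [this] with t h h'
    exact sub_eq_zero.1 (h h')
  intro χ h1 h2 h3
  have hχ : IsTest (Ioo t₀ t₁) χ := ⟨h1, h2, h3⟩
  set m := ∫ t, χ t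
  have hχi : Integrable χ := h1.continuous.integrable_of_hasCompactSupport h2
  have hρi : Integrable ρ := hρ.1.continuous.integrable_of_hasCompactSupport hρ.2.1
  obtain ⟨ψ, hψ, hd⟩ := (hχ.add_mul hρ (-m)).primitive (by
    rw [integral_add hχi (hρi.const_mul (-m)), integral_const_mul, hρ1]
    simp [m])
  have h4 := h ψ hψ
  rw [hd] at h4
  have hχy := integrableOn_continuous_smul hy h1.continuous
  have hρy := integrableOn_continuous_smul hy hρ.1.continuous
  simp only [add_smul, mul_smul] at h4
  rw [integral_add (g := fun t => -m • ρ t • y t) hχy (hρy.smul (-m)), integral_smul] at h4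
  rw [← hχ.setIntegral_eq]
  simp only [smul_sub]
  rw [integral_sub hχy (hχi.integrableOn.smul_const c), integral_smul_const]
  have h5 : ∫ t in Ioo t₀ t₁, χ t = m :=
    setIntegral_eq_integral_of_forall_compl_eq_zero fun t ht => hχ.eq_zero ht
  rw [h5, ← h4, neg_smul]
  abel

theorem exists_isTest_eq_one (ht : t₀ < t₁) : ∃ ψ : ℝ → ℝ, IsTest (Iio t₁) ψ ∧ ψ t₀ = 1 := by
  obtain ⟨f, h1, h2, h3, -, h5⟩ := exists_contDiff_tsupport_subset (n := ⊤) (Iio_mem_nhds ht)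
  exact ⟨f, ⟨h3, h2, h1⟩, h5⟩

/-- The integral is half of `‖∫ x‖²`: it is the integral of `⟪x t, x s⟫` over the triangle `s < t`,
symmetry gives the other triangle the same value, and the diagonal is null. No derivative of `x`
enters. -/
theorem integral_inner_primitive_nonneg {E : Type*} [NormedAddCommGroup E]
    [InnerProductSpace ℝ E] [CompleteSpace E] {x : ℝ → E} (hx : IntegrableOn x (Ioo t₀ t₁)) :
    0 ≤ ∫ t in Ioo t₀ t₁, ⟪x t, ∫ s in t₀..t, x s⟫ := by
  set μ := tvol t₀ t₁
  have hp : Integrable (fun z : ℝ × ℝ => ⟪x z.1, x z.2⟫) (μ.prod μ) :=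
    Integrable.op_fst_snd (op := fun a b : E => (inner ℝ a b : ℝ)) (continuous_inner (𝕜 := ℝ) (E := E))
      ⟨1, fun a b => by simpa using norm_inner_le_norm (𝕜 := ℝ) a b⟩ hx hx
  have hm1 : MeasurableSet {z : ℝ × ℝ | z.2 < z.1} := measurableSet_lt measurable_snd measurable_fst
  have hm2 : MeasurableSet {z : ℝ × ℝ | z.1 < z.2} := measurableSet_lt measurable_fst measurable_snd
  have hi1 := hp.indicator hm1
  have hi2 := hp.indicator hm2
  have e1 : ∫ t in Ioo t₀ t₁, ⟪x t, ∫ s in t₀..t, x s⟫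
      = ∫ t, ∫ s, ({z : ℝ × ℝ | z.2 < z.1}.indicator (fun z => ⟪x z.1, x z.2⟫)) (t, s) ∂μ ∂μ := by
    refine setIntegral_congr_fun measurableSet_Ioo fun t ht' => ?_
    have : ∀ s, ({z : ℝ × ℝ | z.2 < z.1}.indicator (fun z : ℝ × ℝ => ⟪x z.1, x z.2⟫)) (t, s)
        = (Iio t).indicator (fun s => ⟪x t, x s⟫) s := fun s => by
      simp [indicator]
    simp only [this]
    rw [integral_indicator measurableSet_Iio, Measure.restrict_restrict measurableSet_Iio]
    have h2 : Iio t ∩ Ioo t₀ t₁ = Ioo t₀ t := by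
      ext s; simp only [mem_inter_iff, mem_Iio, mem_Ioo]
      exact ⟨fun h => ⟨h.2.1, h.1⟩, fun h => ⟨h.2, h.1, h.2.trans ht'.2⟩⟩
    rw [h2, intervalIntegral.integral_of_le ht'.1.le, integral_Ioc_eq_integral_Ioo]
    exact (integral_inner (hx.mono_set (Ioo_subset_Ioo_right ht'.2.le)) _).symm
  have e2 : ∫ t, ∫ s, ({z : ℝ × ℝ | z.2 < z.1}.indicator (fun z => ⟪x z.1, x z.2⟫)) (t, s) ∂μ ∂μ
      = ∫ t, ∫ s, ({z : ℝ × ℝ | z.1 < z.2}.indicator (fun z => ⟪x z.1, x z.2⟫)) (t, s) ∂μ ∂μ := by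
    rw [integral_integral_swap
      (f := fun t s => ({z : ℝ × ℝ | z.2 < z.1}.indicator (fun z => ⟪x z.1, x z.2⟫)) (t, s)) hi1]
    refine integral_congr_ae (.of_forall fun t => integral_congr_ae (.of_forall fun s => ?_))
    simp [indicator, real_inner_comm]
  have e3 : (∫ t, ∫ s, ({z : ℝ × ℝ | z.2 < z.1}.indicator (fun z => ⟪x z.1, x z.2⟫)) (t, s) ∂μ ∂μ)
      + (∫ t, ∫ s, ({z : ℝ × ℝ | z.1 < z.2}.indicator (fun z => ⟪x z.1, x z.2⟫)) (t, s) ∂μ ∂μ)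
      = ⟪∫ t, x t ∂μ, ∫ t, x t ∂μ⟫ := by
    rw [← integral_add hi1.integral_prod_left hi2.integral_prod_left]
    rw [← integral_inner hx]
    refine integral_congr_ae ?_
    filter_upwards [hi1.prod_right_ae, hi2.prod_right_ae] with t h1 h2
    rw [← integral_add h1 h2, real_inner_comm, ← integral_inner hx]
    refine integral_congr_ae ?_
    filter_upwards [ae_restrict_of_ae (Measure.ae_ne volume t)] with s hs
    rcases lt_or_gt_of_ne hs with h | h
    · simp [indicator, h, h.not_gt]
    · simp [indicator, h, h.not_gt]
  rw [← e2, ← e1] at e3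
  have := real_inner_self_nonneg (x := ∫ t, x t ∂μ)
  linarith

end Abstract
end CFD

namespace CFD
open scoped Topology RealInnerProductSpace

/-! ### Existence and uniqueness for a coercive parabolic problem in Hilbert spaces -/

section Parabolic

variable {t₀ t₁ : ℝ} {V H : Type*} [NormedAddCommGroup V] [InnerProductSpace ℝ V] [CompleteSpace V]
  [NormedAddCommGroup H] [InnerProductSpace ℝ H] [CompleteSpace H]

theorem memLp_of_continuous {E : Type*} [NormedAddCommGroup E] {f : ℝ → E} (hf : Continuous f) :
    MemLp f 2 (tvol t₀ t₁) := by
  have : MemLp f 2 (volume.restrict (Icc t₀ t₁)) := by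
    obtain ⟨C, hC⟩ := isCompact_Icc.exists_bound_of_continuousOn (s := Icc t₀ t₁) hf.continuousOn
    refine MemLp.of_bound hf.aestronglyMeasurable C ?_
    filter_upwards [ae_restrict_mem measurableSet_Icc] with t h using hC t h
  exact this.mono_measure (Measure.restrict_mono Ioo_subset_Icc_self le_rfl)

theorem integrableOn_lp {E : Type*} [NormedAddCommGroup E] (v : Lp E 2 (tvol t₀ t₁)) :
    IntegrableOn v (Ioo t₀ t₁) :=
  (Lp.memLp v).integrable one_le_two

/-- The class in `L²(t₀, t₁; E)` of a continuous function. -/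
noncomputable def contToLp (t₀ t₁ : ℝ) (E : Type*) [NormedAddCommGroup E] [NormedSpace ℝ E] :
    C(ℝ, E) →ₗ[ℝ] Lp E 2 (tvol t₀ t₁) where
  toFun f := (memLp_of_continuous f.continuous).toLp f
  map_add' _ _ := MemLp.toLp_add _ _
  map_smul' _ _ := MemLp.toLp_const_smul _ _

theorem coeFn_contToLp {E : Type*} [NormedAddCommGroup E] [NormedSpace ℝ E] (f : C(ℝ, E)) :
    contToLp t₀ t₁ E f =ᵐ[tvol t₀ t₁] f :=
  MemLp.coeFn_toLp (memLp_of_continuous f.continuous)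

/-- `C¹` functions on the line vanishing at `t₁`. -/
def terminalC1 (t₁ : ℝ) (E : Type*) [NormedAddCommGroup E] [NormedSpace ℝ E] :
    Submodule ℝ (ℝ → E) where
  carrier := {f | ContDiff ℝ 1 f ∧ f t₁ = 0}
  zero_mem' := ⟨contDiff_const, rfl⟩
  add_mem' ha hb := ⟨ha.1.add hb.1, by simp [ha.2, hb.2]⟩
  smul_mem' c _ ha := ⟨contDiff_const.smul ha.1, by simp [ha.2]⟩

/-- A `C¹` function as a continuous function. -/
def terminalC1.toCont (t₁ : ℝ) (E : Type*) [NormedAddCommGroup E] [NormedSpace ℝ E] :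
    terminalC1 t₁ E →ₗ[ℝ] C(ℝ, E) where
  toFun f := ⟨f.1, f.2.1.continuous⟩
  map_add' _ _ := rfl
  map_smul' _ _ := rfl

/-- The derivative of a `C¹` function as a continuous function. -/
noncomputable def terminalC1.derivCont (t₁ : ℝ) (E : Type*) [NormedAddCommGroup E]
    [NormedSpace ℝ E] : terminalC1 t₁ E →ₗ[ℝ] C(ℝ, E) where
  toFun f := ⟨deriv f.1, f.2.1.continuous_deriv le_rfl⟩
  map_add' f g := by
    ext t
    exact deriv_add (f.2.1.differentiable (by simp) t) (g.2.1.differentiable (by simp) t)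
  map_smul' c f := by
    ext t
    exact deriv_const_smul c (f.2.1.differentiable (by simp) t)

omit [CompleteSpace H] in
theorem integral_inner_deriv_self {f : ℝ → H} (ht : t₀ ≤ t₁) (hf : ContDiff ℝ 1 f) (h1 : f t₁ = 0) :
    ∫ t in Ioo t₀ t₁, ⟪f t, deriv f t⟫ = - (‖f t₀‖ ^ 2 / 2) := by
  have hd : ∀ t, HasDerivAt (fun t => ‖f t‖ ^ 2) (2 * ⟪f t, deriv f t⟫) t := fun t =>
    ((hf.differentiable (by simp) t).hasDerivAt).norm_sq
  have := intervalIntegral.integral_eq_sub_of_hasDerivAt (a := t₀) (b := t₁) (fun t _ => hd t)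
    (Continuous.intervalIntegrable (continuous_const.mul
      (hf.continuous.inner (hf.continuous_deriv le_rfl))) _ _)
  rw [intervalIntegral.integral_const_mul, h1, intervalIntegral.integral_of_le ht,
    integral_Ioc_eq_integral_Ioo] at this
  simp at this
  linarith

theorem inner_lp_eq_integral {α : Type*} {m : MeasurableSpace α} {μ : Measure α}
    {E : Type*} [NormedAddCommGroup E] [InnerProductSpace ℝ E] {v w : Lp E 2 μ} {f g : α → E}
    (hf : v =ᵐ[μ] f) (hg : w =ᵐ[μ] g) : ⟪v, w⟫ = ∫ t, ⟪f t, g t⟫ ∂μ := by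
  rw [L2.inner_def]
  refine integral_congr_ae ?_
  filter_upwards [hf, hg] with t h1 h2
  rw [h1, h2]

/-- Existence for the abstract parabolic problem `(ι† ι v)' + A v = F`, `ι v (t₀) = h`. -/
theorem exists_parabolic (ht : t₀ ≤ t₁) (ι : V →L[ℝ] H) (A : V →L[ℝ] V) {c : ℝ} (hc : 0 < c)
    (hA : ∀ v, c * ‖v‖ ^ 2 ≤ ⟪A v, v⟫) (F : Lp V 2 (tvol t₀ t₁)) (h : H) :
    ∃ v : Lp V 2 (tvol t₀ t₁), ∀ f : ℝ → V, ContDiff ℝ 1 f → f t₁ = 0 →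
      - (∫ t in Ioo t₀ t₁, ⟪ι (v t), ι (deriv f t)⟫) + ∫ t in Ioo t₀ t₁, ⟪A (v t), f t⟫
        = (∫ t in Ioo t₀ t₁, ⟪F t, f t⟫) + ⟪h, ι (f t₀)⟫ := by
  let At := ContinuousLinearMap.adjoint A
  let B : V →L[ℝ] V := ContinuousLinearMap.adjoint ι ∘L ι
  let J := contToLp t₀ t₁ V ∘ₗ terminalC1.toCont t₁ V
  let J' := contToLp t₀ t₁ V ∘ₗ terminalC1.derivCont t₁ V
  have hJ : ∀ f, J f =ᵐ[tvol t₀ t₁] f.1 := fun f => coeFn_contToLp _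
  have hJ' : ∀ f, J' f =ᵐ[tvol t₀ t₁] deriv f.1 := fun f => coeFn_contToLp _
  -- `K f = A† f - B f'` moves every operator onto the test function, so that `⟪v, K f⟫ = L f` for
  -- all `f` is the weak equation together with its initial condition.
  let K : terminalC1 t₁ V →ₗ[ℝ] Lp V 2 (tvol t₀ t₁) :=
    (At.compLpL 2 (tvol t₀ t₁)).toLinearMap ∘ₗ J - (B.compLpL 2 (tvol t₀ t₁)).toLinearMap ∘ₗ J'
  let L : terminalC1 t₁ V →ₗ[ℝ] ℝ := (innerSL ℝ F).toLinearMap ∘ₗ J +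
    ((innerSL ℝ h ∘L ι).toLinearMap ∘ₗ LinearMap.proj t₀) ∘ₗ (terminalC1 t₁ V).subtype
  have hK : ∀ (v : Lp V 2 (tvol t₀ t₁)) (f : terminalC1 t₁ V), ⟪v, K f⟫ =
      (∫ t in Ioo t₀ t₁, ⟪A (v t), f.1 t⟫) - ∫ t in Ioo t₀ t₁, ⟪ι (v t), ι (deriv f.1 t)⟫ := by
    intro v f
    have h1 : (At.compLpL 2 (tvol t₀ t₁)) (J f) =ᵐ[tvol t₀ t₁] fun t => At (f.1 t) := by
      filter_upwards [At.coeFn_compLpL (J f), hJ f] with t h1 h2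
      rw [h1, h2]
    have h2 : (B.compLpL 2 (tvol t₀ t₁)) (J' f) =ᵐ[tvol t₀ t₁] fun t => B (deriv f.1 t) := by
      filter_upwards [B.coeFn_compLpL (J' f), hJ' f] with t h1 h2
      rw [h1, h2]
    show ⟪v, (At.compLpL 2 (tvol t₀ t₁)) (J f) - (B.compLpL 2 (tvol t₀ t₁)) (J' f)⟫ = _
    rw [inner_sub_right, inner_lp_eq_integral .rfl h1, inner_lp_eq_integral .rfl h2]
    simp only [At, B, ContinuousLinearMap.comp_apply, ContinuousLinearMap.adjoint_inner_right]
  have hL : ∀ f, L f = ⟪F, J f⟫ + ⟪h, ι (f.1 t₀)⟫ := fun f => rfl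
  -- Pair `K f` with `f` itself. The time term integrates to `‖ι (f t₀)‖² / 2`, with a good sign
  -- since `f` vanishes at `t₁`.
  have hcoer : ∀ f, c * ‖J f‖ ^ 2 + ‖ι (f.1 t₀)‖ ^ 2 / 2 ≤ ‖J f‖ * ‖K f‖ := by
    intro f
    refine le_trans (le_of_le_of_eq ?_ (hK (J f) f).symm) (real_inner_le_norm _ _)
    have h1 : ∫ t in Ioo t₀ t₁, ⟪ι (J f t), ι (deriv f.1 t)⟫ = - (‖ι (f.1 t₀)‖ ^ 2 / 2) := by
      refine Eq.trans ?_ (integral_inner_deriv_self ht (ι.contDiff.comp f.2.1) (by simp [f.2.2]))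
      refine integral_congr_ae ?_
      filter_upwards [hJ f] with t h1
      rw [h1]
      congr 1
      exact ((ι.hasFDerivAt.comp_hasDerivAt t
        (f.2.1.differentiable (by simp) t).hasDerivAt).deriv).symm
    have h2 : c * ‖J f‖ ^ 2 ≤ ∫ t in Ioo t₀ t₁, ⟪A (J f t), f.1 t⟫ := by
      rw [← real_inner_self_eq_norm_sq, L2.inner_def, ← integral_const_mul]
      have h3 := (L2.integrable_inner (𝕜 := ℝ) (A.compLpL 2 (tvol t₀ t₁) (J f)) (J f))
      refine integral_mono_ae ((L2.integrable_inner (𝕜 := ℝ) (J f) (J f)).const_mul c)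
        (h3.congr ?_) ?_
      · filter_upwards [A.coeFn_compLpL (J f), hJ f] with t h1 h2
        rw [h1, h2]
      · filter_upwards [hJ f] with t h1
        rw [h1, real_inner_self_eq_norm_sq]
        exact hA _
    rw [h1]
    linarith
  -- With `x`, `k`, `y` as below, coercivity reads `c x² + y² / 2 ≤ x k`. Hence `x ≤ k / c` and `y²
  -- ≤ 2 x k ≤ 2 k² / c`, which bounds the two terms of `L`.
  obtain ⟨v, hv⟩ := exists_forall_inner_eq K L (‖F‖ / c + ‖h‖ * √(2 / c)) (by
    intro f
    have h0 := hcoer f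
    set x := ‖J f‖
    set k := ‖K f‖
    set y := ‖ι (f.1 t₀)‖
    have hx0 : 0 ≤ x := norm_nonneg _
    have hk0 : 0 ≤ k := norm_nonneg _
    have hy0 : 0 ≤ y := norm_nonneg _
    have hx : x ≤ k / c := by
      rw [le_div_iff₀ hc]
      by_contra! hlt
      have : 0 < x := by
        rcases hx0.eq_or_lt with h | h
        · rw [← h] at hlt; linarith
        · exact h
      nlinarith
    have hy : y ≤ √(2 / c) * k := by
      refine abs_le_of_sq_le_sq' ?_ (by positivity) |>.2
      rw [mul_pow, Real.sq_sqrt (by positivity)]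
      have : x * k ≤ k / c * k := by gcongr
      have h5 : k / c * k = k ^ 2 / c := by ring
      have h6 : 2 / c * k ^ 2 = 2 * (k ^ 2 / c) := by ring
      nlinarith [mul_nonneg hc.le (sq_nonneg x)]
    rw [hL]
    calc |⟪F, J f⟫ + ⟪h, ι (f.1 t₀)⟫| ≤ ‖F‖ * x + ‖h‖ * y :=
          (abs_add_le _ _).trans (add_le_add (abs_real_inner_le_norm _ _)
            (abs_real_inner_le_norm _ _))
      _ ≤ ‖F‖ * (k / c) + ‖h‖ * (√(2 / c) * k) := by gcongr
      _ = _ := by ring)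
  refine ⟨v, fun f hf h1 => ?_⟩
  have := hv ⟨f, hf, h1⟩
  rw [hK, hL, inner_lp_eq_integral .rfl (hJ _)] at this
  linarith

/-- Uniqueness for the abstract parabolic problem. -/
theorem eq_zero_of_parabolic (ht : t₀ < t₁) (ι : V →L[ℝ] H) (hι : Function.Injective ι)
    (A : V →L[ℝ] V) {c : ℝ} (hc : 0 < c) (hA : ∀ v, c * ‖v‖ ^ 2 ≤ ⟪A v, v⟫) {S : Set V}
    (hS : Dense S) (v : Lp V 2 (tvol t₀ t₁))
    (hv : ∀ φ ∈ S, ∀ ψ, IsTest (Iio t₁) ψ →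
      - (∫ t in Ioo t₀ t₁, deriv ψ t * ⟪ι (v t), ι φ⟫)
        + ∫ t in Ioo t₀ t₁, ψ t * ⟪A (v t), φ⟫ = 0) : v = 0 := by
  let B : V →L[ℝ] V := ContinuousLinearMap.adjoint ι ∘L ι
  have hB : ∀ a b, ⟪B a, b⟫ = ⟪ι a, ι b⟫ := fun a b => by
    simp [B, ContinuousLinearMap.adjoint_inner_left]
  have hvi : IntegrableOn v (Ioo t₀ t₁) := integrableOn_lp v
  have hvI : IntervalIntegrable v volume t₀ t₁ := by
    rwa [intervalIntegrable_iff_integrableOn_Ioo_of_le ht.le]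
  have hBi : IntegrableOn (fun t => B (v t)) (Ioo t₀ t₁) := B.integrable_comp hvi
  have hAi : IntegrableOn (fun t => A (v t)) (Ioo t₀ t₁) := A.integrable_comp hvi
  let W : ℝ → V := fun t => ∫ s in t₀..t, v s
  have hWc : ContinuousOn W (Icc t₀ t₁) := by
    have := intervalIntegral.continuousOn_primitive_interval' hvI left_mem_uIcc
    rwa [uIcc_of_le ht.le] at this
  have hAW : ∀ t ∈ Icc t₀ t₁, A (W t) = ∫ s in t₀..t, A (v s) := fun t h =>
    (A.intervalIntegral_comp_comm (hvI.mono_set (by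
      rw [uIcc_of_le h.1, uIcc_of_le ht.le]; exact Icc_subset_Icc_right h.2))).symm
  have hWi : ∀ T : V →L[ℝ] V, IntegrableOn (fun t => T (W t)) (Ioo t₀ t₁) := fun T =>
    ((T.continuous.comp_continuousOn hWc).integrableOn_Icc).mono_set Ioo_subset_Icc_self
  have hyi : IntegrableOn (fun t => B (v t) + A (W t)) (Ioo t₀ t₁) := hBi.add (hWi A)
  -- Integrating the `A` term by parts puts `ψ'` on both terms; density of `S` then turns the tested
  -- identities into an identity in `V`.
  have key : ∀ ψ, IsTest (Iio t₁) ψ →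
      ∫ t in Ioo t₀ t₁, deriv ψ t • (B (v t) + A (W t)) = 0 := by
    intro ψ hψ
    have hψ' : Continuous (deriv ψ) := hψ.deriv.1.continuous
    have h1 : ∫ t in Ioo t₀ t₁, ψ t • A (v t) = - ∫ t in Ioo t₀ t₁, deriv ψ t • A (W t) := by
      rw [integral_smul_eq_neg_integral_deriv_smul_primitive ht.le hAi (hψ.1.of_le (by simp))
        (hψ.eq_zero (by simp))]
      congr 1
      refine setIntegral_congr_fun measurableSet_Ioo fun t h => ?_
      simp only [hAW t (Ioo_subset_Icc_self h)]
    simp only [smul_add]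
    rw [integral_add (integrableOn_continuous_smul hBi hψ')
      (integrableOn_continuous_smul (hWi A) hψ'), ← neg_eq_iff_eq_neg.2 h1]
    refine hS.eq_zero_of_inner_left (𝕜 := ℝ) fun φ hφ => ?_
    have h2 := hv φ hφ ψ hψ
    have h3 : ∫ t in Ioo t₀ t₁, deriv ψ t * ⟪ι (v t), ι φ⟫
        = ⟪∫ t in Ioo t₀ t₁, deriv ψ t • B (v t), φ⟫ := by
      rw [real_inner_comm, ← integral_inner (integrableOn_continuous_smul hBi hψ')]
      refine integral_congr_ae (.of_forall fun t => ?_)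
      simp only [inner_smul_right]
      rw [← hB, real_inner_comm]
    have h4 : ∫ t in Ioo t₀ t₁, ψ t * ⟪A (v t), φ⟫ = ⟪∫ t in Ioo t₀ t₁, ψ t • A (v t), φ⟫ := by
      rw [real_inner_comm, ← integral_inner (integrableOn_continuous_smul hAi hψ.1.continuous)]
      refine integral_congr_ae (.of_forall fun t => ?_)
      simp only [inner_smul_right]
      rw [real_inner_comm]
    rw [inner_add_left, inner_neg_left, ← h3, ← h4]
    linarith
  obtain ⟨z, hz⟩ := exists_ae_eq_const_of_forall_integral_deriv_smul ht hyi
    fun ψ hψ => key ψ (hψ.mono Ioo_subset_Iio_self)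
  -- The test functions in `key` need not vanish at `t₀`. One with `ψ t₀ = 1` gives `∫ ψ' • z = -z`,
  -- which encodes the zero initial value.
  have hz0 : z = 0 := by
    obtain ⟨ψ, hψ, h1⟩ := exists_isTest_eq_one ht
    have h2 := key ψ hψ
    rw [integral_congr_ae (g := fun t => deriv ψ t • z)
      (by filter_upwards [hz] with t h; rw [h]), integral_smul_const,
      ← integral_Ioc_eq_integral_Ioo, ← intervalIntegral.integral_of_le ht.le,
      intervalIntegral.integral_deriv_eq_sub
        (fun t _ => hψ.1.differentiable (by simp) t)
        (hψ.deriv.1.continuous.intervalIntegrable _ _), h1, hψ.eq_zero (by simp)] at h2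
    simpa using h2
  subst hz0
  have hιi : IntegrableOn (fun t => ι (v t)) (Ioo t₀ t₁) := ι.integrable_comp hvi
  have hιW : ∀ t ∈ Icc t₀ t₁, ι (W t) = ∫ s in t₀..t, ι (v s) := fun t h =>
    (ι.intervalIntegral_comp_comm (hvI.mono_set (by
      rw [uIcc_of_le h.1, uIcc_of_le ht.le]; exact Icc_subset_Icc_right h.2))).symm
  -- Since `B v = -A W`, the integrand is `⟪ι v, ι W⟫`, whose integral is nonnegative; coercivity
  -- gives the opposite sign, so `W` vanishes almost everywhere.
  have hpos : 0 ≤ ∫ t in Ioo t₀ t₁, - ⟪A (W t), W t⟫ := by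
    refine (integral_inner_primitive_nonneg hιi).trans_eq (integral_congr_ae ?_)
    filter_upwards [hz, ae_restrict_mem measurableSet_Ioo] with t h1 h2
    rw [← hιW t (Ioo_subset_Icc_self h2), ← hB, eq_neg_of_add_eq_zero_left h1, inner_neg_left]
  have hAWi : IntegrableOn (fun t => ⟪A (W t), W t⟫) (Ioo t₀ t₁) :=
    (((A.continuous.comp_continuousOn hWc).inner hWc).integrableOn_Icc).mono_set
      Ioo_subset_Icc_self
  have hnn : ∀ t, 0 ≤ ⟪A (W t), W t⟫ := fun t => le_trans (by positivity) (hA (W t))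
  have h0 : ∀ᵐ t ∂(tvol t₀ t₁), ⟪A (W t), W t⟫ = 0 := by
    refine (integral_eq_zero_iff_of_nonneg hnn hAWi).1 (le_antisymm ?_ (integral_nonneg hnn))
    rw [integral_neg] at hpos
    linarith
  refine Lp.ext ?_
  filter_upwards [h0, hz, Lp.coeFn_zero V 2 (tvol t₀ t₁)] with t h1 h2 h3
  rw [h3, Pi.zero_apply]
  have h4 := hA (W t)
  rw [h1] at h4
  have h5 : W t = 0 := by
    have : ‖W t‖ ^ 2 ≤ 0 := by nlinarith [sq_nonneg ‖W t‖]
    simpa using le_antisymm this (sq_nonneg _)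
  rw [h5, map_zero, add_zero] at h2
  have h6 := hB (v t) (v t)
  rw [h2, inner_zero_left] at h6
  have h7 : ι (v t) = 0 := inner_self_eq_zero.1 h6.symm
  exact hι (h7.trans (map_zero ι).symm)

end Parabolic
end CFD

namespace CFD
open scoped Topology RealInnerProductSpace

/-! ### Completeness of `H¹`, uniqueness of weak gradients, test functions in `H¹₀` -/

section Sobolev

variable {d : ℕ} {Ω : Set (Pt d)}

/-- The inclusion `H¹(Ω) → L²(Ω)`. -/
noncomputable def valL (Ω : Set (Pt d)) : H1 Ω →L[ℝ] Lp ℝ 2 (vol Ω) :=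
  WithLp.fstL 2 ℝ _ _ ∘L (H1 Ω).subtypeL

/-- The weak gradient `H¹(Ω) → L²(Ω; ℝ^d)`. -/
noncomputable def gradL (Ω : Set (Pt d)) : H1 Ω →L[ℝ] Lp (Pt d) 2 (vol Ω) :=
  WithLp.sndL 2 ℝ _ _ ∘L (H1 Ω).subtypeL

/-- The weak partial derivative `∂_i : H¹(Ω) → L²(Ω)`. -/
noncomputable def partialL (Ω : Set (Pt d)) (i : Fin d) : H1 Ω →L[ℝ] Lp ℝ 2 (vol Ω) :=
  (EuclideanSpace.proj (𝕜 := ℝ) i : Pt d →L[ℝ] ℝ).compLpL 2 (vol Ω) ∘L gradL Ω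

theorem valL_apply (v : H1 Ω) : valL Ω v = val v := rfl

theorem coeFn_coord (g : Lp (Pt d) 2 (vol Ω)) (i : Fin d) :
    (EuclideanSpace.proj (𝕜 := ℝ) i : Pt d →L[ℝ] ℝ).compLpL 2 (vol Ω) g
      =ᵐ[vol Ω] fun x => g x i :=
  ContinuousLinearMap.coeFn_compLpL _ g

theorem coeFn_partialL (v : H1 Ω) (i : Fin d) :
    partialL Ω i v =ᵐ[vol Ω] fun x => grad v x i :=
  coeFn_coord (grad v) i

theorem norm_sq_eq (v : H1 Ω) : ‖v‖ ^ 2 = ‖val v‖ ^ 2 + ‖grad v‖ ^ 2 :=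
  WithLp.prod_norm_sq_eq_of_L2 v.1

theorem inner_lp_eq_integral_mul {α : Type*} {m : MeasurableSpace α} {μ : Measure α}
    {v w : Lp ℝ 2 μ} {f g : α → ℝ}
    (hf : v =ᵐ[μ] f) (hg : w =ᵐ[μ] g) : ⟪v, w⟫ = ∫ t, f t * g t ∂μ := by
  rw [inner_lp_eq_integral hf hg]
  simp [mul_comm]

theorem norm_grad_sq (v : H1 Ω) : ‖grad v‖ ^ 2 = ∑ i, ‖partialL Ω i v‖ ^ 2 := by
  simp only [← real_inner_self_eq_norm_sq]
  rw [L2.inner_def]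
  have h : ∀ i, ⟪partialL Ω i v, partialL Ω i v⟫ = ∫ x in Ω, grad v x i * grad v x i := fun i =>
    inner_lp_eq_integral_mul (coeFn_partialL v i) (coeFn_partialL v i)
  simp only [h]
  refine Eq.trans ?_ (integral_finsetSum _ fun i _ => (memLp_coord (grad v) i).integrable_mul
    (memLp_coord (grad v) i))
  refine integral_congr_ae (.of_forall fun x => ?_)
  simp [EuclideanSpace.real_norm_sq_eq]
  simp [pow_two]

/-- Each tested identity is a closed condition in `L² × L²`, being an equation between continuous
functionals. Closedness makes `H1 Ω` a Hilbert space. -/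
theorem isClosed_H1 (Ω : Set (Pt d)) :
    IsClosed (H1 Ω : Set (WithLp 2 (Lp ℝ 2 (vol Ω) × Lp (Pt d) 2 (vol Ω)))) := by
  have : (H1 Ω : Set (WithLp 2 (Lp ℝ 2 (vol Ω) × Lp (Pt d) 2 (vol Ω)))) =
      ⋂ (i : Fin d) (φ : Pt d → ℝ) (h : IsTest Ω φ),
        {z | ⟪z.fst, (h.memLp_pd i).toLp⟫ + ⟪(EuclideanSpace.proj (𝕜 := ℝ) i :
          Pt d →L[ℝ] ℝ).compLpL 2 (vol Ω) z.snd, h.memLp.toLp⟫ = 0} := by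
    ext z
    simp only [mem_iInter, mem_ofPred_eq]
    refine forall_congr' fun i => forall_congr' fun φ => forall_congr' fun h => ?_
    rw [inner_lp_eq_integral_mul .rfl (h.memLp_pd i).coeFn_toLp,
      inner_lp_eq_integral_mul (coeFn_coord z.snd i) h.memLp.coeFn_toLp, add_eq_zero_iff_eq_neg]
  rw [this]
  refine isClosed_iInter fun i => isClosed_iInter fun φ => isClosed_iInter fun h => ?_
  refine isClosed_eq ?_ continuous_const
  have h1 := (WithLp.fstL 2 ℝ (Lp ℝ 2 (vol Ω)) (Lp (Pt d) 2 (vol Ω))).continuous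
  have h2 := (WithLp.sndL 2 ℝ (Lp ℝ 2 (vol Ω)) (Lp (Pt d) 2 (vol Ω))).continuous
  exact (h1.inner continuous_const).add
    (((ContinuousLinearMap.continuous _).comp h2).inner continuous_const)

instance : CompleteSpace (H1 Ω) := (isClosed_H1 Ω).completeSpace_coe

instance : CompleteSpace (H10 Ω) :=
  (Submodule.isClosed_topologicalClosure (testH1 Ω)).completeSpace_coe

theorem tsupport_pd_subset (i : Fin d) (φ : Pt d → ℝ) : tsupport (pd i φ) ⊆ tsupport φ :=
  tsupport_fderiv_apply_subset ℝ _

theorem IsTest.pd {φ : Pt d → ℝ} (h : IsTest Ω φ) (i : Fin d) : IsTest Ω (pd i φ) :=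
  ⟨(h.1.fderiv_right (m := ∞) (by simp)).clm_apply contDiff_const,
    h.2.1.fderiv_apply (𝕜 := ℝ) _, (tsupport_pd_subset i φ).trans h.2.2⟩

theorem IsTest.setIntegral_mul_left {χ : Pt d → ℝ} (hχ : IsTest Ω χ) (y : Pt d → ℝ) :
    ∫ t in Ω, y t * χ t = ∫ t, y t * χ t :=
  setIntegral_eq_integral_of_forall_compl_eq_zero fun t ht => by rw [hχ.eq_zero ht, mul_zero]

theorem IsTest.integral_mul_pd {φ χ : Pt d → ℝ} (h : IsTest Ω φ) (k : IsTest Ω χ) (i : Fin d) :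
    ∫ x in Ω, φ x * CFD.pd i χ x = - ∫ x in Ω, CFD.pd i φ x * χ x := by
  rw [(k.pd i).setIntegral_mul_left, k.setIntegral_mul_left]
  refine integral_mul_fderiv_eq_neg_fderiv_mul_of_integrable ?_ ?_ ?_
    (fun x _ => h.1.differentiable (by simp) x) (fun x _ => k.1.differentiable (by simp) x)
  · exact ((h.pd i).1.continuous.mul k.1.continuous).integrable_of_hasCompactSupport
      k.2.1.mul_left
  · exact (h.1.continuous.mul (k.pd i).1.continuous).integrable_of_hasCompactSupport
      (k.pd i).2.1.mul_left
  · exact (h.1.continuous.mul k.1.continuous).integrable_of_hasCompactSupport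
      k.2.1.mul_left

theorem IsTest.exists_H1 {φ : Pt d → ℝ} (h : IsTest Ω φ) :
    ∃ v : H1 Ω, v ∈ testH1 Ω ∧ val v =ᵐ[vol Ω] φ ∧
      ∀ i, (fun x => grad v x i) =ᵐ[vol Ω] CFD.pd i φ := by
  let G : Pt d → Pt d := fun x => WithLp.toLp 2 fun i => CFD.pd i φ x
  have hG : MemLp G 2 (vol Ω) := by
    refine Continuous.memLp_of_hasCompactSupport ?_ ?_
    · exact (PiLp.continuous_toLp 2 _).comp (continuous_pi fun i => (h.pd i).1.continuous)
    · refine (h.2.1.fderiv (𝕜 := ℝ)).comp_left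
        (g := fun L : Pt d →L[ℝ] ℝ => (WithLp.toLp 2 fun i => L (EuclideanSpace.single i 1) : Pt d))
        ?_
      ext i; simp
  have hg : ∀ i, (fun x => hG.toLp G x i) =ᵐ[vol Ω] CFD.pd i φ := fun i => by
    filter_upwards [hG.coeFn_toLp] with x hx
    rw [hx]
  have hv : val (⟨WithLp.toLp 2 (h.memLp.toLp φ, hG.toLp G), ?_⟩ : H1 Ω) =ᵐ[vol Ω] φ :=
    h.memLp.coeFn_toLp
  · exact ⟨_, ⟨φ, h, hv⟩, hv, hg⟩
  · intro i χ k
    show ∫ x in Ω, h.memLp.toLp φ x * CFD.pd i χ x = - ∫ x in Ω, hG.toLp G x i * χ x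
    rw [integral_congr_ae (g := fun x => φ x * CFD.pd i χ x), h.integral_mul_pd k,
      integral_congr_ae (f := fun x => hG.toLp G x i * χ x) (g := fun x => CFD.pd i φ x * χ x)]
    · filter_upwards [hg i] with x hx
      rw [hx]
    · filter_upwards [h.memLp.coeFn_toLp] with x hx
      rw [hx]

theorem isWeakGrad_ae_eq_zero (hΩ : IsOpen Ω) {f : Pt d → ℝ} (hf : MemLp f 2 (vol Ω))
    (h : ∀ φ, IsTest Ω φ → ∫ x in Ω, f x * φ x = 0) : f =ᵐ[vol Ω] 0 := by
  have hl : LocallyIntegrableOn f Ω := by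
    rw [locallyIntegrableOn_iff hΩ.isLocallyClosed]
    intro k hk hkc
    have : IsFiniteMeasure (volume.restrict k) :=
      ⟨by simpa using hkc.measure_lt_top⟩
    exact (hf.mono_measure (Measure.restrict_mono hk le_rfl)).integrable one_le_two
  have := hΩ.ae_eq_zero_of_integral_contDiff_smul_eq_zero hl fun φ h1 h2 h3 => by
    have k : IsTest Ω φ := ⟨h1, h2, h3⟩
    rw [← k.setIntegral_eq, ← h φ k]
    simp [mul_comm]
  rw [EventuallyEq, ae_restrict_iff' hΩ.measurableSet]
  exact this

/-- As elements of `H1 Ω` are pairs, this is uniqueness of the weak gradient. It later gives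
injectivity of `ι`, the last step of parabolic uniqueness. -/
theorem valL_injective (hΩ : IsOpen Ω) : Function.Injective (valL Ω) := by
  rw [injective_iff_map_eq_zero]
  intro v hv
  have h0 : ∀ i, (fun x => grad v x i) =ᵐ[vol Ω] 0 := fun i =>
    isWeakGrad_ae_eq_zero hΩ (memLp_coord (grad v) i) fun φ hφ => by
      have := v.2 i φ hφ
      rw [show v.1.fst = 0 from hv] at this
      rw [← neg_eq_iff_eq_neg] at this
      refine this.symm.trans ?_
      rw [neg_eq_zero]
      refine integral_eq_zero_of_ae ?_
      filter_upwards [Lp.coeFn_zero ℝ 2 (vol Ω)] with x hx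
      rw [hx]; simp
  have hp : ∀ i, partialL Ω i v = 0 := fun i =>
    Lp.ext (((coeFn_partialL v i).trans (h0 i)).trans (Lp.coeFn_zero ℝ 2 (vol Ω)).symm)
  have h1 := norm_sq_eq v
  rw [norm_grad_sq, show val v = 0 from hv] at h1
  simpa [hp] using h1

theorem grad_ae_eq_of_val_ae_eq (hΩ : IsOpen Ω) {v : H1 Ω} {φ : Pt d → ℝ} (h : IsTest Ω φ)
    (hv : val v =ᵐ[vol Ω] φ) (i : Fin d) : (fun x => grad v x i) =ᵐ[vol Ω] pd i φ := by
  obtain ⟨w, -, h1, h2⟩ := h.exists_H1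
  have : v = w := valL_injective hΩ (Lp.ext (hv.trans h1.symm))
  exact this ▸ h2 i

/-- Density of `C_c^∞(Ω)` in `H¹₀(Ω)`. -/
theorem dense_testH1 (Ω : Set (Pt d)) : Dense {v : H10 Ω | (v : H1 Ω) ∈ testH1 Ω} := by
  intro v
  rw [closure_subtype]
  have : ((↑) '' {v : H10 Ω | (v : H1 Ω) ∈ testH1 Ω} : Set (H1 Ω)) = testH1 Ω := by
    ext x
    constructor
    · rintro ⟨a, h, rfl⟩
      exact h
    · exact fun h => ⟨⟨x, (testH1 Ω).le_topologicalClosure h⟩, h, rfl⟩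
  rw [this]
  exact v.2

end Sobolev
end CFD

namespace CFD
open scoped Topology RealInnerProductSpace NNReal

/-! ### Sobolev and Poincaré inequalities, multiplication operators, skewness of advection -/

section Forms

variable {d : ℕ} {Ω : Set (Pt d)}

/-- The Hilbert space `H¹₀(Ω)`, as a type of its own. -/
def H10Space (Ω : Set (Pt d)) : Type := H10 Ω

noncomputable instance : NormedAddCommGroup (H10Space Ω) :=
  inferInstanceAs (NormedAddCommGroup (H10 Ω))

noncomputable instance : InnerProductSpace ℝ (H10Space Ω) :=
  inferInstanceAs (InnerProductSpace ℝ (H10 Ω))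

instance : CompleteSpace (H10Space Ω) := inferInstanceAs (CompleteSpace (H10 Ω))

/-- The inclusion `H¹₀(Ω) → H¹(Ω)`. -/
noncomputable def inclL (Ω : Set (Pt d)) : H10Space Ω →L[ℝ] H1 Ω := (H10 Ω).subtypeL

theorem inclL_mem (v : H10Space Ω) : inclL Ω v ∈ H10 Ω := Subtype.property (p := (· ∈ H10 Ω)) v

theorem norm_inclL (v : H10Space Ω) : ‖inclL Ω v‖ = ‖v‖ := rfl

theorem exists_inclL_eq {v : H1 Ω} (h : v ∈ H10 Ω) : ∃ w, inclL Ω w = v := ⟨⟨v, h⟩, rfl⟩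

/-- The orthogonal projection of `H¹(Ω)` onto `H¹₀(Ω)`. -/
theorem exists_proj (Ω : Set (Pt d)) :
    ∃ P : H1 Ω →L[ℝ] H10Space Ω, ∀ v ∈ H10 Ω, inclL Ω (P v) = v :=
  ⟨(H10 Ω).orthogonalProjectionOnto, fun _ hv =>
    Submodule.starProjection_eq_self_iff.2 hv⟩

/-- Density of `C_c^∞(Ω)` in `H¹₀(Ω)`. -/
theorem dense_test (Ω : Set (Pt d)) : Dense {v : H10Space Ω | inclL Ω v ∈ testH1 Ω} :=
  dense_testH1 Ω

theorem norm_le_norm_toLp_apply_single (L : Pt d →L[ℝ] ℝ) :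
    ‖L‖ ≤ ‖(WithLp.toLp 2 fun i => L (EuclideanSpace.single i 1) : Pt d)‖ := by
  refine L.opNorm_le_bound (norm_nonneg _) fun x => ?_
  have : L x = ⟪(WithLp.toLp 2 fun i => L (EuclideanSpace.single i 1) : Pt d), x⟫ := by
    have h := (EuclideanSpace.basisFun (Fin d) ℝ).sum_repr x
    conv_lhs => rw [← h]
    simp [PiLp.inner_apply, map_sum]
  rw [this]
  exact norm_inner_le_norm _ _

theorem exists_eLpNorm_four_le_fderiv_of_lt {p : ℝ≥0} (hΩb : Bornology.IsBounded Ω) (hp1 : 1 ≤ p)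
    (hpd : p < (d : ℝ≥0)) (hpq : (p : ℝ)⁻¹ - (d : ℝ)⁻¹ ≤ 4⁻¹) :
    ∃ C : ℝ≥0, ∀ φ : Pt d → ℝ, IsTest Ω φ →
      eLpNorm φ 4 (vol Ω) ≤ C * eLpNorm (fderiv ℝ φ) p (vol Ω) := by
  refine ⟨eLpNormLESNormFDerivOfLeConst ℝ (volume : Measure (Pt d)) Ω p 4, fun φ h => ?_⟩
  have hsup : Function.support (fderiv ℝ φ) ⊆ Ω := (support_fderiv_subset ℝ).trans h.2.2
  have h1 := eLpNorm_le_eLpNorm_fderiv_of_le (q := 4) (volume : Measure (Pt d))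
    (h.1.of_le (by simp)) ((subset_tsupport φ).trans h.2.2) hp1 (by simpa using hpd)
    (by simpa using hpq) hΩb
  have hsup' : Function.support (fun x => ‖fderiv ℝ φ x‖) ⊆ Ω := by
    intro x hx
    exact hsup (norm_ne_zero_iff.1 hx)
  have h2 := eLpNorm_restrict_eq_of_support_subset (μ := volume) (p := (p : ℝ≥0∞)) hsup'
  rw [eLpNorm_norm, eLpNorm_norm] at h2
  rw [← h2] at h1
  exact (eLpNorm_mono_measure φ Measure.restrict_le_self).trans h1

/-- Sobolev's inequality for functions in `C_c^∞(Ω)`, in dimensions two and three. -/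
theorem exists_eLpNorm_four_le_fderiv (hd : d = 2 ∨ d = 3) (hΩb : Bornology.IsBounded Ω) :
    ∃ C : ℝ≥0, ∀ φ : Pt d → ℝ, IsTest Ω φ →
      eLpNorm φ 4 (vol Ω) ≤ C * eLpNorm (fderiv ℝ φ) 2 (vol Ω) := by
  have hfin : volume Ω ≠ ⊤ := hΩb.measure_lt_top.ne
  -- The Sobolev exponent must stay below `d`. For `d = 2` this excludes `p = 2`, and `4/3` is the
  -- value with `1/p - 1/2 = 1/4`; for `d = 3`, `p = 2` gives `1/6 ≤ 1/4`. Hölder on the bounded `Ω`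
  -- then passes from `p` to `2`.
  obtain ⟨p, hp1, hp2, hpd, hpq⟩ : ∃ p : ℝ≥0, 1 ≤ p ∧ p ≤ 2 ∧ p < (d : ℝ≥0) ∧
      (p : ℝ)⁻¹ - (d : ℝ)⁻¹ ≤ 4⁻¹ := by
    rcases hd with rfl | rfl
    · refine ⟨4 / 3, ?_, ?_, ?_, ?_⟩
      · rw [le_div_iff₀ (by norm_num)]; norm_num
      · rw [div_le_iff₀ (by norm_num)]; norm_num
      · rw [div_lt_iff₀ (by norm_num)]; norm_num
      · norm_num
    · refine ⟨2, ?_, ?_, ?_, ?_⟩ <;> norm_num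
  obtain ⟨K, hK⟩ := exists_eLpNorm_four_le_fderiv_of_lt hΩb hp1 hpd hpq
  have hp2' : (p : ℝ≥0∞) ≤ 2 := by exact_mod_cast hp2
  obtain ⟨M, hM⟩ : ∃ M : ℝ≥0, (M : ℝ≥0∞) =
      volume Ω ^ (1 / (p : ℝ≥0∞).toReal - 1 / (2 : ℝ≥0∞).toReal) := by
    refine ⟨_, ENNReal.coe_toNNReal (ENNReal.rpow_ne_top_of_nonneg ?_ hfin)⟩
    have : (p : ℝ) ≤ 2 := by exact_mod_cast hp2
    have h1 : (1 : ℝ) ≤ p := by exact_mod_cast hp1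
    simp only [ENNReal.coe_toReal, ENNReal.toReal_ofNat, sub_nonneg]
    gcongr
  refine ⟨K * M, fun φ h => (hK φ h).trans ?_⟩
  have h1 := eLpNorm_le_eLpNorm_mul_rpow_measure_univ (μ := vol Ω) hp2'
    (h.1.continuous_fderiv (by simp)).aestronglyMeasurable
  rw [Measure.restrict_apply_univ, ← hM] at h1
  calc _ ≤ K * (eLpNorm (fderiv ℝ φ) 2 (vol Ω) * M) := by gcongr
    _ = _ := by rw [ENNReal.coe_mul]; ring

/-- Sobolev's inequality in `H¹₀(Ω)`. -/
theorem exists_eLpNorm_four_le (hd : d = 2 ∨ d = 3) (hΩ : IsOpen Ω)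
    (hΩb : Bornology.IsBounded Ω) :
    ∃ C : ℝ≥0, ∀ v ∈ H10 Ω, eLpNorm (val v) 4 (vol Ω) ≤ C * ‖grad v‖ₑ := by
  obtain ⟨C, hC⟩ := exists_eLpNorm_four_le_fderiv hd hΩb
  have htest : ∀ v ∈ testH1 Ω, eLpNorm (val v) 4 (vol Ω) ≤ C * ‖grad v‖ₑ := by
    rintro v ⟨φ, h, hv⟩
    rw [eLpNorm_congr_ae hv, Lp.enorm_def]
    refine (hC φ h).trans ?_
    gcongr
    refine eLpNorm_mono_ae ?_
    filter_upwards [ae_all_iff.2 fun i => grad_ae_eq_of_val_ae_eq hΩ h hv i] with x hx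
    refine (norm_le_norm_toLp_apply_single _).trans_eq ?_
    congr 1
    ext i
    exact (hx i).symm
  refine ⟨C, fun v hv => ?_⟩
  obtain ⟨w, hw, hlim⟩ := mem_closure_iff_seq_limit.1 hv
  have h1 : Tendsto (fun n => val (w n)) atTop (𝓝 (val v)) :=
    ((valL Ω).continuous.tendsto v).comp hlim
  have h2 : Tendsto (fun n => grad (w n)) atTop (𝓝 (grad v)) :=
    ((gradL Ω).continuous.tendsto v).comp hlim
  -- Approximation in `H¹` controls only `L²` convergence of the values, so the `L⁴` bound passes to
  -- the limit by Fatou along an almost everywhere convergent subsequence.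
  obtain ⟨ns, hns, hae⟩ := (tendstoInMeasure_of_tendsto_Lp h1).exists_seq_tendsto_ae
  refine (Lp.eLpNorm_lim_le_liminf_eLpNorm (fun n => Lp.aestronglyMeasurable (val (w (ns n)))) _
    hae).trans ?_
  have h3 : Tendsto (fun n => (C : ℝ≥0∞) * ‖grad (w (ns n))‖ₑ) atTop (𝓝 (C * ‖grad v‖ₑ)) :=
    ENNReal.Tendsto.const_mul ((h2.comp hns.tendsto_atTop).enorm) (Or.inr ENNReal.coe_ne_top)
  rw [← h3.liminf_eq]
  exact liminf_le_liminf (.of_forall fun n => htest _ (hw _))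

/-- The Poincaré–Friedrichs inequality. -/
theorem exists_norm_val_le (hd : d = 2 ∨ d = 3) (hΩ : IsOpen Ω) (hΩb : Bornology.IsBounded Ω) :
    ∃ C : ℝ≥0, ∀ v ∈ H10 Ω, ‖val v‖ ≤ C * ‖grad v‖ := by
  obtain ⟨C, hC⟩ := exists_eLpNorm_four_le hd hΩ hΩb
  have hfin : volume Ω ≠ ⊤ := hΩb.measure_lt_top.ne
  set M := (volume Ω ^ (1 / (2 : ℝ≥0∞).toReal - 1 / (4 : ℝ≥0∞).toReal))
  have hM : M ≠ ⊤ := ENNReal.rpow_ne_top_of_nonneg (by norm_num) hfin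
  refine ⟨C * M.toNNReal, fun v hv => ?_⟩
  have h : ‖val v‖ₑ ≤ (C * M.toNNReal : ℝ≥0) * ‖grad v‖ₑ := by
    rw [Lp.enorm_def]
    -- Poincaré follows from the `L⁴` inequality, as `Ω` has finite measure.
    have h24 : (2 : ℝ≥0∞) ≤ 4 := by norm_num
    refine (eLpNorm_le_eLpNorm_mul_rpow_measure_univ h24
      (Lp.aestronglyMeasurable _)).trans ?_
    rw [Measure.restrict_apply_univ, ENNReal.coe_mul, ENNReal.coe_toNNReal hM]
    calc _ ≤ C * ‖grad v‖ₑ * M := by gcongr; exact hC v hv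
      _ = _ := by ring
  rw [← enorm_norm, ← enorm_norm (grad v), ← ofReal_norm, ← ofReal_norm] at h
  have := ENNReal.toReal_mono (by finiteness) h
  simpa using this

/-- Multiplication by a function `m` as a bounded operator, composed with `T`. -/
theorem exists_mul_clm {α : Type*} {mα : MeasurableSpace α} {μ : Measure α} {X : Type*}
    [NormedAddCommGroup X] [NormedSpace ℝ X] (T : X →L[ℝ] Lp ℝ 2 μ) {m : α → ℝ}
    (hm : AEStronglyMeasurable m μ) (C : ℝ≥0)
    (h : ∀ x, eLpNorm (fun a => m a * T x a) 2 μ ≤ C * ‖x‖ₑ) :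
    ∃ Q : X →L[ℝ] Lp ℝ 2 μ, ∀ x, Q x =ᵐ[μ] fun a => m a * T x a := by
  have hL : ∀ x, MemLp (fun a => m a * T x a) 2 μ := fun x =>
    ⟨hm.mul (Lp.aestronglyMeasurable _), (h x).trans_lt (by finiteness)⟩
  let Q : X →ₗ[ℝ] Lp ℝ 2 μ :=
    { toFun := fun x => (hL x).toLp
      map_add' := fun x y => by
        refine Lp.ext ?_
        filter_upwards [(hL (x + y)).coeFn_toLp, (hL x).coeFn_toLp, (hL y).coeFn_toLp,
          Lp.coeFn_add (hL x).toLp (hL y).toLp, Lp.coeFn_add (T x) (T y)] with a h1 h2 h3 h4 h5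
        rw [h1, h4, Pi.add_apply, h2, h3, map_add, h5, Pi.add_apply, mul_add]
      map_smul' := fun c x => by
        refine Lp.ext ?_
        filter_upwards [(hL (c • x)).coeFn_toLp, (hL x).coeFn_toLp,
          Lp.coeFn_smul c (hL x).toLp, Lp.coeFn_smul c (T x)] with a h1 h2 h4 h5
        simp only [RingHom.id_apply]
        rw [h1, h4, Pi.smul_apply, h2, map_smul, h5, Pi.smul_apply, smul_eq_mul, smul_eq_mul]
        ring }
  refine ⟨Q.mkContinuous C fun x => ?_, fun x => (hL x).coeFn_toLp⟩
  show ‖(hL x).toLp‖ ≤ _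
  rw [Lp.norm_toLp]
  have := ENNReal.toReal_mono (by finiteness) (h x)
  simpa using this

theorem exists_mul_clm_top {α : Type*} {mα : MeasurableSpace α} {μ : Measure α} {m : α → ℝ}
    (hm : MemLp m ⊤ μ) :
    ∃ Q : Lp ℝ 2 μ →L[ℝ] Lp ℝ 2 μ, ∀ x, Q x =ᵐ[μ] fun a => m a * x a := by
  refine exists_mul_clm (ContinuousLinearMap.id ℝ _) hm.1 (eLpNorm m ⊤ μ).toNNReal fun x => ?_
  rw [ENNReal.coe_toNNReal hm.2.ne, Lp.enorm_def]
  have := eLpNorm_smul_le_mul_eLpNorm (p := ⊤) (q := 2) (r := 2) (Lp.aestronglyMeasurable x) hm.1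
  exact this

/-- Hölder with `1/4 + 1/4 = 1/2` and the Sobolev inequality. Applied to the components of `u`, it
lets the factor `u j` move onto the test function, leaving an `L²` pairing with the gradient. -/
theorem exists_mul_clm_four (hd : d = 2 ∨ d = 3) (hΩ : IsOpen Ω) (hΩb : Bornology.IsBounded Ω)
    {m : Pt d → ℝ} (hm : MemLp m 4 (vol Ω)) :
    ∃ Q : H10Space Ω →L[ℝ] Lp ℝ 2 (vol Ω), ∀ v : H10Space Ω,
      Q v =ᵐ[vol Ω] fun x => m x * val (inclL Ω v) x := by
  obtain ⟨C, hC⟩ := exists_eLpNorm_four_le hd hΩ hΩb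
  refine exists_mul_clm (valL Ω ∘L inclL Ω) hm.1
    ((eLpNorm m 4 (vol Ω)).toNNReal * C) fun v => ?_
  have : ENNReal.HolderTriple 4 4 2 := ⟨by
    rw [← ENNReal.toReal_eq_toReal_iff' (by simp) (by simp), ENNReal.toReal_add (by simp) (by simp)]
    norm_num⟩
  refine (eLpNorm_smul_le_mul_eLpNorm (p := 4) (q := 4) (r := 2)
    (Lp.aestronglyMeasurable (val (inclL Ω v))) hm.1).trans ?_
  rw [ENNReal.coe_mul, ENNReal.coe_toNNReal hm.2.ne, mul_assoc]
  gcongr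
  refine (hC _ (inclL_mem v)).trans ?_
  gcongr
  rw [enorm_le_iff_norm_le, ← norm_inclL]
  have h1 := norm_sq_eq (inclL Ω v)
  exact le_of_sq_le_sq (by nlinarith [sq_nonneg ‖val (inclL Ω v)‖]) (norm_nonneg _)

/-- The velocity of a flow is in `L⁴`. -/
theorem memLp_four_of_sub_mem (hd : d = 2 ∨ d = 3) (hΩ : IsOpen Ω) (hΩb : Bornology.IsBounded Ω)
    {u b : H1 Ω} (h : u - b ∈ H10 Ω) (hb : MemLp (val b) 4 (vol Ω)) :
    MemLp (val u) 4 (vol Ω) := by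
  obtain ⟨C, hC⟩ := exists_eLpNorm_four_le hd hΩ hΩb
  have h1 : MemLp (val (u - b)) 4 (vol Ω) :=
    ⟨Lp.aestronglyMeasurable _, (hC _ h).trans_lt (by finiteness)⟩
  refine (h1.add hb).ae_eq ?_
  filter_upwards [Lp.coeFn_sub (val u) (val b)] with x hx
  have : val (u - b) = val u - val b := rfl
  rw [Pi.add_apply, this, hx]
  simp

theorem pd_sq {φ : Pt d → ℝ} (h : IsTest Ω φ) (i : Fin d) (x : Pt d) :
    pd i (fun x => φ x * φ x) x = 2 * (φ x * pd i φ x) := by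
  have := h.1.differentiable (by simp) x
  simp only [pd]
  rw [fderiv_fun_mul this this]
  simp
  ring

/-- `⟨u · ∇φ, φ⟩ = 0` for a divergence free velocity `u`. -/
theorem integral_advect_self {u : Vel Ω} (hu : ∀ᵐ x ∂(vol Ω), ∑ i, grad (u i) x i = 0)
    {φ : Pt d → ℝ} (h : IsTest Ω φ) :
    ∑ j, ∫ x in Ω, pd j φ x * (val (u j) x * φ x) = 0 := by
  -- As `φ ∂_j φ = ∂_j (φ²) / 2`, testing the weak gradient of `u j` with `φ²` and summing over `j`
  -- leaves `-1/2 ∫ (div u) φ² = 0`.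
  have h2 : IsTest Ω (fun x => φ x * φ x) :=
    ⟨h.1.mul h.1, h.2.1.mul_left,
      (closure_mono (Function.support_mul_subset_right _ _)).trans h.2.2⟩
  have h3 : ∀ j, ∫ x in Ω, pd j φ x * (val (u j) x * φ x)
      = - (1 / 2) * ∫ x in Ω, grad (u j) x j * (φ x * φ x) := by
    intro j
    have := (u j).2 j _ h2
    have e : ∫ x in Ω, (u j).1.fst x * pd j (fun x => φ x * φ x) x
        = 2 * ∫ x in Ω, pd j φ x * (val (u j) x * φ x) := by
      rw [← integral_const_mul]
      refine integral_congr_ae (.of_forall fun x => ?_)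
      simp only [pd_sq h]
      show val (u j) x * _ = _
      ring
    rw [e] at this
    have h4 : ∫ x in Ω, grad (u j) x j * (φ x * φ x)
      = ∫ x in Ω, (u j).1.snd x j * (φ x * φ x) := rfl
    rw [h4]
    linarith
  simp only [h3]
  have h5 := integral_finsetSum (μ := vol Ω) Finset.univ fun j _ =>
    (memLp_coord (grad (u j)) j).integrable_mul h2.memLp
  simp only [Pi.mul_apply] at h5
  rw [← Finset.mul_sum, ← h5, integral_eq_zero_of_ae, mul_zero]
  filter_upwards [hu] with x hx
  have : ∑ j, grad (u j) x j * (φ x * φ x) = 0 := by rw [← Finset.sum_mul, hx, zero_mul]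
  simpa using this

end Forms
end CFD

namespace CFD
open scoped Topology RealInnerProductSpace NNReal Convolution

/-! ### Functions with zero weak gradient and uniqueness of the pressure -/

section Constancy

variable {d : ℕ} {Ω : Set (Pt d)}

/-- The derivative of the convolution falls on the smooth factor and is, up to sign, the weak
gradient identity tested with `y ↦ φ (x - y)`. -/
theorem convolution_eq_of_weak_grad_eq_zero {g φ : Pt d → ℝ} (hg : LocallyIntegrable g)
    (hφ : ContDiff ℝ ∞ φ) (hφc : HasCompactSupport φ) {x : Pt d}
    (h : ∀ i, ∫ y, g y * pd i (fun y => φ (x - y)) y = 0) :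
    HasFDerivAt (φ ⋆[ContinuousLinearMap.lsmul ℝ ℝ, volume] g) (0 : Pt d →L[ℝ] ℝ) x := by
  have h1 := hφc.hasFDerivAt_convolution_left (ContinuousLinearMap.lsmul ℝ ℝ)
    (hφ.of_le (by simp) : ContDiff ℝ 1 φ) hg x
  have h2 : ConvolutionExists (fderiv ℝ φ) g
      ((ContinuousLinearMap.lsmul ℝ ℝ).precompL (Pt d)) volume :=
    (hφc.fderiv (𝕜 := ℝ)).convolutionExists_left _ (hφ.continuous_fderiv (by simp)) hg
  have h3 : ∀ i, (fderiv ℝ φ ⋆[(ContinuousLinearMap.lsmul ℝ ℝ).precompL (Pt d), volume] g) x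
      (EuclideanSpace.single i 1) = 0 := by
    intro i
    rw [convolution_eq_swap, ContinuousLinearMap.integral_apply
      ((h2 x).integrable_swap), ← neg_eq_zero, ← integral_neg, ← h i]
    refine integral_congr_ae (.of_forall fun y => ?_)
    have h4 : fderiv ℝ (fun y => φ (x - y)) y = - fderiv ℝ φ (x - y) := by
      have := ((hφ.differentiable (by simp) (x - y)).hasFDerivAt.comp y
        ((hasFDerivAt_const x y).sub (hasFDerivAt_id y))).fderiv
      refine Eq.trans this ?_
      ext; simp
    simp only [pd, h4]
    simp [ContinuousLinearMap.precompL_apply, mul_comm]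
  have h5 : (fderiv ℝ φ ⋆[(ContinuousLinearMap.lsmul ℝ ℝ).precompL (Pt d), volume] g) x = 0 := by
    refine ContinuousLinearMap.coe_injective
      ((EuclideanSpace.basisFun (Fin d) ℝ).toBasis.ext fun i => ?_)
    simpa using h3 i
  rwa [h5] at h1

/-- A function with vanishing weak gradient is locally constant. -/
theorem exists_ball_ae_const (hΩ : IsOpen Ω) {f : Pt d → ℝ} (hf : MemLp f 2 (vol Ω))
    (h : ∀ i φ, IsTest Ω φ → ∫ x in Ω, f x * pd i φ x = 0) {x₀ : Pt d} (hx : x₀ ∈ Ω) :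
    ∃ r > 0, ∃ c, ∀ᵐ y, y ∈ Metric.ball x₀ r → f y = c := by
  obtain ⟨R, hR, hball⟩ := Metric.isOpen_iff.1 hΩ x₀ hx
  set g := Ω.indicator f
  have hg : LocallyIntegrable g :=
    ((memLp_indicator_iff_restrict hΩ.measurableSet).2 hf).locallyIntegrable one_le_two
  -- Outer radii at most `R / 2` keep bumps centred in the half ball supported in `Ω`. The fixed
  -- ratio 2 of the radii is what almost everywhere convergence of the mollifications requires.
  let b : ℕ → ContDiffBump (0 : Pt d) := fun n =>
    ⟨R / 4 / (n + 1), R / 2 / (n + 1), by positivity, by gcongr; norm_num⟩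
  let F : ℕ → Pt d → ℝ := fun n =>
    (b n).normed volume ⋆[ContinuousLinearMap.lsmul ℝ ℝ, volume] g
  have hlim : ∀ᵐ y, Tendsto (fun n => F n y) atTop (𝓝 (g y)) := by
    refine ContDiffBump.ae_convolution_tendsto_right_of_locallyIntegrable (K := 2) ?_
      (.of_forall fun n => ?_) hg
    · exact tendsto_const_div_atTop_nhds_zero_nat (R / 2) |>.comp (tendsto_add_atTop_nat 1)
        |>.congr fun n => by simp [b]
    · show R / 2 / (n + 1) ≤ 2 * (R / 4 / (n + 1))
      exact le_of_eq (by ring)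
  have hout : ∀ n, (b n).rOut ≤ R / 2 := fun n => by
    show R / 2 / (n + 1) ≤ R / 2
    exact div_le_self (by positivity) (by simp)
  have hF : ∀ n, ∀ y ∈ Metric.ball x₀ (R / 2), HasFDerivAt (F n) (0 : Pt d →L[ℝ] ℝ) y := by
    intro n y hy
    refine convolution_eq_of_weak_grad_eq_zero hg (b n).contDiff_normed
      (b n).hasCompactSupport_normed fun i => ?_
    have hsup : Function.support (fun z => (b n).normed volume (y - z)) ⊆
        Metric.closedBall y (R / 2) := by
      intro z hz
      have : y - z ∈ Metric.ball (0 : Pt d) (b n).rOut := by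
        rw [← (b n).support_normed_eq (μ := volume)]; exact hz
      rw [mem_ball_zero_iff] at this
      rw [mem_closedBall_iff_norm']
      exact this.le.trans (hout n)
    have ht : IsTest Ω (fun z => (b n).normed volume (y - z)) := by
      refine ⟨(b n).contDiff_normed.comp (contDiff_const.sub contDiff_id),
        HasCompactSupport.intro (isCompact_closedBall y (R / 2)) fun z hz => ?_,
        (closure_minimal hsup Metric.isClosed_closedBall).trans
          ((Metric.closedBall_subset_ball' ?_).trans hball)⟩
      · by_contra h'; exact hz (hsup h')
      · rw [Metric.mem_ball] at hy; linarith
    rw [← h i _ ht, ← integral_indicator hΩ.measurableSet]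
    refine integral_congr_ae (.of_forall fun z => ?_)
    by_cases hz : z ∈ Ω <;> simp [g, hz]
  -- Each mollification is constant on the half ball, hence equal to its value at `x₀`; the limit of
  -- these values is the constant.
  refine ⟨R / 2, by positivity, limUnder atTop fun n => F n x₀, ?_⟩
  filter_upwards [hlim] with y hy hyb
  have hyΩ : y ∈ Ω := hball (Metric.ball_subset_ball (by linarith) hyb)
  have hgy : g y = f y := indicator_of_mem hyΩ f
  rw [← hgy]
  refine (Tendsto.limUnder_eq (hy.congr fun n => ?_)).symm
  refine (convex_ball x₀ (R / 2)).is_const_of_fderivWithin_eq_zero (𝕜 := ℝ)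
    (fun z hz => (hF n z hz).differentiableAt.differentiableWithinAt) (fun z hz => ?_) hyb
    (Metric.mem_ball_self (by positivity))
  exact (hF n z hz).hasFDerivWithinAt.fderivWithin
    (Metric.isOpen_ball.uniqueDiffWithinAt hz)

/-- A function with vanishing weak gradient on a connected open set is constant. -/
theorem exists_ae_const (hΩ : IsOpen Ω) (hΩc : IsConnected Ω) {f : Pt d → ℝ}
    (hf : MemLp f 2 (vol Ω)) (h : ∀ i φ, IsTest Ω φ → ∫ x in Ω, f x * pd i φ x = 0) :
    ∃ c, ∀ᵐ x ∂(vol Ω), f x = c := by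
  obtain ⟨x₁, hx₁⟩ := hΩc.nonempty
  obtain ⟨r₁, hr₁, c, hc⟩ := exists_ball_ae_const hΩ hf h hx₁
  -- The sets `S c` are open, pairwise disjoint and cover `Ω`, so connectedness leaves only one of
  -- them.
  let S : ℝ → Set (Pt d) := fun c => {x | ∃ r > 0, ∀ᵐ y, y ∈ Metric.ball x r → f y = c}
  have hS : ∀ c, IsOpen (S c) := by
    intro c
    rw [Metric.isOpen_iff]
    rintro x ⟨r, hr, hx⟩
    refine ⟨r / 2, by positivity, fun z hz => ⟨r / 2, by positivity, ?_⟩⟩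
    filter_upwards [hx] with y hy hyz
    refine hy ?_
    have := dist_triangle y z x
    rw [Metric.mem_ball] at *
    linarith
  have hdisj : ∀ a b x, x ∈ S a → x ∈ S b → a = b := by
    rintro a b x ⟨r, hr, h1⟩ ⟨s, hs, h2⟩
    by_contra hab
    have h0 : ∀ᵐ y, y ∉ Metric.ball x (min r s) := by
      filter_upwards [h1, h2] with y h1 h2 hy
      exact hab ((h1 (Metric.ball_subset_ball (min_le_left _ _) hy)).symm.trans
        (h2 (Metric.ball_subset_ball (min_le_right _ _) hy)))
    have h3 : volume (Metric.ball x (min r s)) = 0 := by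
      have := measure_eq_zero_iff_ae_notMem.2 h0
      exact this
    exact (Metric.measure_ball_pos volume x (lt_min hr hs)).ne' h3
  have hΩS : Ω ⊆ S c := by
    by_contra hn
    obtain ⟨x₂, hx₂, hn⟩ := not_subset.1 hn
    have hT : IsOpen (⋃ b ∈ {b | b ≠ c}, S b) := isOpen_biUnion fun b _ => hS b
    have hcov : ∀ x ∈ Ω, x ∈ S c ∪ ⋃ b ∈ {b | b ≠ c}, S b := by
      intro x hx
      obtain ⟨r, hr, b, hb⟩ := exists_ball_ae_const hΩ hf h hx
      by_cases hbc : b = c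
      · exact Or.inl ⟨r, hr, hbc ▸ hb⟩
      · exact Or.inr (mem_biUnion (x := b) hbc ⟨r, hr, hb⟩)
    obtain ⟨y, -, hy1, hy2⟩ := hΩc.isPreconnected _ _ (hS c) hT hcov ⟨x₁, hx₁, r₁, hr₁, hc⟩
      ⟨x₂, hx₂, (hcov x₂ hx₂).resolve_left hn⟩
    obtain ⟨b, hb, hy2⟩ := mem_iUnion₂.1 hy2
    exact hb (hdisj _ _ y hy2 hy1)
  refine ⟨c, ?_⟩
  rw [ae_restrict_iff' hΩ.measurableSet, ae_iff]
  refine measure_null_of_locally_null _ fun x hx => ?_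
  have hx' : x ∈ Ω := by
    by_contra h'; exact hx fun h'' => absurd h'' h'
  obtain ⟨r, hr, hxr⟩ := hΩS hx'
  refine ⟨_, inter_mem_nhdsWithin _ (Metric.ball_mem_nhds x hr), measure_mono_null ?_ (ae_iff.1 hxr)⟩
  rintro y ⟨hy1, hy2⟩ h'
  exact hy1 fun _ => h' hy2

/-- The pressure of a flow is determined by its velocity. -/
theorem IsFlow.pressure_unique {t₀ t₁ : ℝ} (hΩ : IsOpen Ω) (hΩb : Bornology.IsBounded Ω)
    (hΩc : IsConnected Ω) {D : Data Ω t₀ t₁} {u : Vel Ω} {p q : Pres Ω} (hp : IsFlow D u p)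
    (hq : IsFlow D u q) : p = q := by
  have hfin : IsFiniteMeasure (vol Ω) := ⟨by
    rw [Measure.restrict_apply_univ]; exact hΩb.measure_lt_top⟩
  have hm : MemLp (fun x => p x - q x) 2 (vol Ω) := (Lp.memLp p).sub (Lp.memLp q)
  obtain ⟨c, hc⟩ := exists_ae_const hΩ hΩc hm fun i φ hφ => by
    have h1 := hp.2.2.2 i φ hφ
    have h2 := hq.2.2.2 i φ hφ
    simp only [sub_mul]
    have h3 := integral_sub ((Lp.memLp p).integrable_mul (hφ.memLp_pd i))
      ((Lp.memLp q).integrable_mul (hφ.memLp_pd i))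
    simp only [Pi.mul_apply] at h3
    rw [h3]
    linarith
  have h1 : ∫ x in Ω, (p x - q x) = 0 := by
    rw [integral_sub ((Lp.memLp p).integrable one_le_two) ((Lp.memLp q).integrable one_le_two),
      hp.2.2.1, hq.2.2.1, sub_zero]
  -- The mean of the constant `p - q` is zero and `Ω` has positive finite measure, so the constant
  -- is zero.
  rw [integral_congr_ae hc, integral_const, smul_eq_mul] at h1
  have hpos : (vol Ω).real univ ≠ 0 := by
    rw [measureReal_def, Measure.restrict_apply_univ]
    exact (ENNReal.toReal_pos (hΩ.measure_pos volume hΩc.nonempty).ne'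
      hΩb.measure_lt_top.ne).ne'
  have hc0 : c = 0 := (mul_eq_zero.1 h1).resolve_left hpos
  refine Lp.ext ?_
  filter_upwards [hc] with x hx
  rw [hc0] at hx
  linarith

end Constancy
end CFD

namespace CFD
open scoped Topology RealInnerProductSpace NNReal

/-! ### Weak solutions with boundary values in an abstract setting -/

section WeakSolution

variable {t₀ t₁ : ℝ} {X V H : Type*} [NormedAddCommGroup X] [NormedSpace ℝ X]
  [NormedAddCommGroup V] [InnerProductSpace ℝ V] [NormedAddCommGroup H] [InnerProductSpace ℝ H]

/-- The element `t ↦ ψ(t) w` of `L²(t₀, t₁; F)`. -/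
noncomputable def tens (t₀ t₁ : ℝ) {F : Type*} [NormedAddCommGroup F] [InnerProductSpace ℝ F]
    {ψ : ℝ → ℝ} (hψ : Continuous ψ) (w : F) : Lp F 2 (tvol t₀ t₁) :=
  contToLp t₀ t₁ F ⟨fun t => ψ t • w, hψ.smul continuous_const⟩

theorem inner_tens {F : Type*} [NormedAddCommGroup F] [InnerProductSpace ℝ F]
    {ψ : ℝ → ℝ} (hψ : Continuous ψ) (w : F) (y : Lp F 2 (tvol t₀ t₁)) :
    ⟪y, tens t₀ t₁ hψ w⟫ = ∫ t in Ioo t₀ t₁, ψ t * ⟪y t, w⟫ := by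
  rw [tens, inner_lp_eq_integral .rfl (coeFn_contToLp _)]
  simp [inner_smul_right]

theorem inner_compLpL_tens {E F : Type*} [NormedAddCommGroup E] [NormedSpace ℝ E]
    [NormedAddCommGroup F] [InnerProductSpace ℝ F] (L : E →L[ℝ] F)
    {ψ : ℝ → ℝ} (hψ : Continuous ψ) (w : F) (y : Lp E 2 (tvol t₀ t₁)) :
    ⟪L.compLpL 2 (tvol t₀ t₁) y, tens t₀ t₁ hψ w⟫ = ∫ t in Ioo t₀ t₁, ψ t * ⟪L (y t), w⟫ := by
  rw [inner_tens]
  refine integral_congr_ae ?_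
  filter_upwards [L.coeFn_compLpL y] with t h
  rw [h]

theorem inner_add_compLpL_tens {E F : Type*} [NormedAddCommGroup E] [NormedSpace ℝ E]
    [NormedAddCommGroup F] [InnerProductSpace ℝ F] (L L' : E →L[ℝ] F)
    {ψ : ℝ → ℝ} (hψ : Continuous ψ) (w : F) (y : Lp E 2 (tvol t₀ t₁)) :
    ⟪(L + L').compLpL 2 (tvol t₀ t₁) y, tens t₀ t₁ hψ w⟫
      = (∫ t in Ioo t₀ t₁, ψ t * ⟪L (y t), w⟫) + ∫ t in Ioo t₀ t₁, ψ t * ⟪L' (y t), w⟫ := by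
  rw [ContinuousLinearMap.add_compLpL, add_apply, inner_add_left,
    inner_compLpL_tens, inner_compLpL_tens]

theorem inner_adjoint_compLpL_tens {E F : Type*} [NormedAddCommGroup E] [InnerProductSpace ℝ E]
    [CompleteSpace E] [NormedAddCommGroup F] [InnerProductSpace ℝ F] [CompleteSpace F]
    (L : E →L[ℝ] F) {ψ : ℝ → ℝ} (hψ : Continuous ψ) (w : E) (y : Lp F 2 (tvol t₀ t₁)) :
    ⟪(ContinuousLinearMap.adjoint L).compLpL 2 (tvol t₀ t₁) y, tens t₀ t₁ hψ w⟫
      = ⟪y, tens t₀ t₁ hψ (L w)⟫ := by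
  rw [inner_compLpL_tens, inner_tens]
  simp only [ContinuousLinearMap.adjoint_inner_left]

/-- The trace at the initial time of a function with a weak time derivative. -/
theorem exists_initial_trace (ht : t₀ < t₁) [CompleteSpace H] (N : X →L[ℝ] H)
    {G : Lp X 2 (tvol t₀ t₁)} {G' : Lp H 2 (tvol t₀ t₁)}
    (h : ∀ ψ : ℝ → ℝ, IsTest (Ioo t₀ t₁) ψ →
      ∫ t in Ioo t₀ t₁, deriv ψ t • N (G t) = - ∫ t in Ioo t₀ t₁, ψ t • G' t) :
    ∃ c : H, ∀ (w : H) (ψ : ℝ → ℝ) (hψ : IsTest (Iio t₁) ψ),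
      - ⟪N.compLpL 2 (tvol t₀ t₁) G, tens t₀ t₁ hψ.deriv.1.continuous w⟫
        = ⟪G', tens t₀ t₁ hψ.1.continuous w⟫ + ψ t₀ * ⟪c, w⟫ := by
  have hG' : IntegrableOn G' (Ioo t₀ t₁) := integrableOn_lp G'
  have hGv : IntegrableOn (fun t => N (G t)) (Ioo t₀ t₁) :=
    N.integrable_comp (integrableOn_lp G)
  have hXi : IntegrableOn (fun t => ∫ s in t₀..t, G' s) (Ioo t₀ t₁) := by
    have : ContinuousOn (fun t => ∫ s in t₀..t, G' s) (uIcc t₀ t₁) :=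
      intervalIntegral.continuousOn_primitive_interval'
        (by rwa [intervalIntegrable_iff_integrableOn_Ioo_of_le ht.le]) left_mem_uIcc
    rw [uIcc_of_le ht.le] at this
    exact this.integrableOn_Icc.mono_set Ioo_subset_Icc_self
  have hibp : ∀ ψ, IsTest (Iio t₁) ψ → ∫ t in Ioo t₀ t₁, ψ t • G' t
      = - ∫ t in Ioo t₀ t₁, deriv ψ t • ∫ s in t₀..t, G' s := fun ψ hψ =>
    integral_smul_eq_neg_integral_deriv_smul_primitive ht.le hG' (hψ.1.of_le (by simp))
      (hψ.eq_zero (by simp))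
  -- `N G` minus the primitive of `G'` has zero weak derivative; since the primitive vanishes at
  -- `t₀`, the resulting constant is the initial value of `N G`.
  obtain ⟨c, hc⟩ := exists_ae_eq_const_of_forall_integral_deriv_smul ht (hGv.sub hXi)
    fun ψ hψ => by
      have hd := hψ.deriv.1.continuous
      simp only [Pi.sub_apply, smul_sub]
      rw [integral_sub (integrableOn_continuous_smul hGv hd) (integrableOn_continuous_smul hXi hd),
        h ψ hψ, hibp ψ (hψ.mono Ioo_subset_Iio_self), neg_neg, sub_self]
  refine ⟨c, fun w ψ hψ => ?_⟩
  have hd := hψ.deriv.1.continuous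
  have h1 : ∫ t in Ioo t₀ t₁, deriv ψ t • N (G t)
      = - (∫ t in Ioo t₀ t₁, ψ t • G' t) - ψ t₀ • c := by
    have h2 : ∫ t in Ioo t₀ t₁, deriv ψ t • N (G t)
        = ∫ t in Ioo t₀ t₁, (deriv ψ t • (∫ s in t₀..t, G' s) + deriv ψ t • c) := by
      refine integral_congr_ae ?_
      filter_upwards [hc] with t h
      rw [← smul_add, ← h]
      simp
    have h3 : ∫ t in Ioo t₀ t₁, deriv ψ t = - ψ t₀ := by
      rw [← integral_Ioc_eq_integral_Ioo, ← intervalIntegral.integral_of_le ht.le,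
        intervalIntegral.integral_deriv_eq_sub (fun t _ => hψ.1.differentiable (by simp) t)
        (hd.intervalIntegrable _ _), hψ.eq_zero (by simp), zero_sub]
    rw [h2, integral_add (integrableOn_continuous_smul hXi hd)
      ((hd.integrableOn_Icc.mono_set Ioo_subset_Icc_self).smul_const c), integral_smul_const, h3,
      hibp ψ hψ]
    simp [sub_eq_add_neg]
  have pair : ∀ (y : ℝ → H) (χ : ℝ → ℝ), IntegrableOn y (Ioo t₀ t₁) → Continuous χ →
      ∫ t in Ioo t₀ t₁, χ t * ⟪y t, w⟫ = ⟪∫ t in Ioo t₀ t₁, χ t • y t, w⟫ := by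
    intro y χ hy hχ
    rw [real_inner_comm, ← integral_inner (integrableOn_continuous_smul hy hχ)]
    refine integral_congr_ae (.of_forall fun t => ?_)
    simp only [inner_smul_right]
    rw [real_inner_comm]
  rw [inner_compLpL_tens, inner_tens, pair _ _ hG' hψ.1.continuous, pair _ _ hGv hd, h1,
    inner_sub_left, inner_neg_left, real_inner_smul_left]
  ring

/-- `T` is a weak solution of `(N T)' + A T = g`, `T - Tb ∈ M`, `N T (t₀) = π`, tested against
`i w` for `w ∈ S`. -/
def IsWeakSol (N : X →L[ℝ] H) (i : V →L[ℝ] X) (A : X →L[ℝ] V) (M : Submodule ℝ X) (S : Set V)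
    (g : Lp H 2 (tvol t₀ t₁)) (Tb : Lp X 2 (tvol t₀ t₁)) (π : H) (T : Lp X 2 (tvol t₀ t₁)) : Prop :=
  (∀ᵐ t ∂(tvol t₀ t₁), T t - Tb t ∈ M) ∧
  ∀ w ∈ S, ∀ (ψ : ℝ → ℝ) (hψ : IsTest (Iio t₁) ψ),
    - ⟪N.compLpL 2 (tvol t₀ t₁) T, tens t₀ t₁ hψ.deriv.1.continuous (N (i w))⟫
      + ⟪A.compLpL 2 (tvol t₀ t₁) T, tens t₀ t₁ hψ.1.continuous w⟫
    = ⟪g, tens t₀ t₁ hψ.1.continuous (N (i w))⟫ + ψ t₀ * ⟪π, N (i w)⟫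

variable {N : X →L[ℝ] H} {i : V →L[ℝ] X} {A : X →L[ℝ] V} {M : Submodule ℝ X} {S : Set V}

/-- Joint linearity in the data and the solution. With `s = -1` it reduces uniqueness to zero data;
with general `s` it gives affine dependence on the initial value. -/
theorem IsWeakSol.add_smul {g g' : Lp H 2 (tvol t₀ t₁)} {Tb Tb' : Lp X 2 (tvol t₀ t₁)} {π π' : H}
    {T T' : Lp X 2 (tvol t₀ t₁)} (h : IsWeakSol N i A M S g Tb π T)
    (h' : IsWeakSol N i A M S g' Tb' π' T') (s : ℝ) :
    IsWeakSol N i A M S (g + s • g') (Tb + s • Tb') (π + s • π') (T + s • T') := by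
  refine ⟨?_, fun w hw ψ hψ => ?_⟩
  · filter_upwards [h.1, h'.1, Lp.coeFn_add T (s • T'), Lp.coeFn_add Tb (s • Tb'),
      Lp.coeFn_smul s T', Lp.coeFn_smul s Tb'] with t h1 h2 h3 h4 h5 h6
    rw [h3, h4, Pi.add_apply, Pi.add_apply, h5, h6, Pi.smul_apply, Pi.smul_apply]
    convert M.add_mem h1 (M.smul_mem s h2) using 1
    rw [smul_sub]
    abel
  · have e := h.2 w hw ψ hψ
    have e' := h'.2 w hw ψ hψ
    simp only [map_add, map_smul, inner_add_left, real_inner_smul_left]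
    linear_combination e + s * e'

theorem isWeakSol_add_iff {A' : X →L[ℝ] V} {g : Lp H 2 (tvol t₀ t₁)} {Tb : Lp X 2 (tvol t₀ t₁)}
    {π : H} {T : Lp X 2 (tvol t₀ t₁)} :
    IsWeakSol N i (A + A') M S g Tb π T ↔ (∀ᵐ t ∂(tvol t₀ t₁), T t - Tb t ∈ M) ∧
      ∀ w ∈ S, ∀ ψ : ℝ → ℝ, IsTest (Iio t₁) ψ →
        - (∫ t in Ioo t₀ t₁, deriv ψ t * ⟪N (T t), N (i w)⟫)
          + (∫ t in Ioo t₀ t₁, ψ t * ⟪A (T t), w⟫) + (∫ t in Ioo t₀ t₁, ψ t * ⟪A' (T t), w⟫)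
        = (∫ t in Ioo t₀ t₁, ψ t * ⟪g t, N (i w)⟫) + ψ t₀ * ⟪π, N (i w)⟫ := by
  refine and_congr_right fun _ => forall₄_congr fun w _ ψ hψ => ?_
  rw [inner_add_compLpL_tens, inner_compLpL_tens, inner_tens, ← add_assoc]

variable [CompleteSpace V] [CompleteSpace H]

/-- With zero boundary data `T` takes values in `M`, so `T = i v` with `v = P T`, and
`eq_zero_of_parabolic` applies to `v`. -/
theorem IsWeakSol.eq_zero (ht : t₀ < t₁) (hN : Function.Injective (N ∘L i)) {P : X →L[ℝ] V}
    (hP : ∀ x ∈ M, i (P x) = x) {c : ℝ} (hc : 0 < c)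
    (hA : ∀ w, c * ‖w‖ ^ 2 ≤ ⟪A (i w), w⟫) (hS : Dense S) {T : Lp X 2 (tvol t₀ t₁)}
    (h : IsWeakSol N i A M S 0 0 0 T) : T = 0 := by
  let v := P.compLpL 2 (tvol t₀ t₁) T
  have hvT : i.compLpL 2 (tvol t₀ t₁) v = T := by
    refine Lp.ext ?_
    filter_upwards [i.coeFn_compLpL v, P.coeFn_compLpL T, h.1,
      Lp.coeFn_zero X 2 (tvol t₀ t₁)] with t h1 h2 h3 h4
    rw [h4, Pi.zero_apply, sub_zero] at h3
    rw [h1, h2, hP _ h3]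
  have hv := eq_zero_of_parabolic ht (N ∘L i) hN (A ∘L i) hc hA hS v fun w hw ψ hψ => by
      have e := h.2 w hw ψ hψ
      rw [inner_zero_left, inner_zero_left, mul_zero, add_zero,
        ← hvT, inner_compLpL_tens, inner_compLpL_tens] at e
      rw [← e]
      congr 1
      · refine congrArg Neg.neg (integral_congr_ae ?_)
        filter_upwards [i.coeFn_compLpL v] with t h
        rw [h]; rfl
      · refine integral_congr_ae ?_
        filter_upwards [i.coeFn_compLpL v] with t h
        rw [h]; rfl
  rw [← hvT, hv]
  exact map_zero (i.compLpL 2 (tvol t₀ t₁))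

/-- Write `T = Tb + i v`. The correction `v` has source `ι† (g - G') - A Tb` and initial value `π -
b`, where `b` is the initial trace of `N Tb`. -/
theorem exists_isWeakSol (ht : t₀ < t₁) (hi : ∀ w, i w ∈ M) {c : ℝ} (hc : 0 < c)
    (hA : ∀ w, c * ‖w‖ ^ 2 ≤ ⟪A (i w), w⟫) (g : Lp H 2 (tvol t₀ t₁)) {Tb : Lp X 2 (tvol t₀ t₁)}
    {G' : Lp H 2 (tvol t₀ t₁)} (hTb : ∀ ψ : ℝ → ℝ, IsTest (Ioo t₀ t₁) ψ →
      ∫ t in Ioo t₀ t₁, deriv ψ t • N (Tb t) = - ∫ t in Ioo t₀ t₁, ψ t • G' t) (π : H) :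
    ∃ T, IsWeakSol N i A M S g Tb π T := by
  obtain ⟨b, hb⟩ := exists_initial_trace ht N hTb
  let ι := N ∘L i
  obtain ⟨v, hv⟩ := exists_parabolic ht.le ι (A ∘L i) hc hA
    ((ContinuousLinearMap.adjoint ι).compLpL 2 (tvol t₀ t₁) (g - G')
      - A.compLpL 2 (tvol t₀ t₁) Tb) (π - b)
  refine ⟨Tb + i.compLpL 2 (tvol t₀ t₁) v, ?_, fun w hw ψ hψ => ?_⟩
  · filter_upwards [Lp.coeFn_add Tb (i.compLpL 2 (tvol t₀ t₁) v), i.coeFn_compLpL v] with t h1 h2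
    rw [h1, Pi.add_apply, h2, add_sub_cancel_left]
    exact hi _
  have hψd : ∀ t, deriv (fun t => ψ t • w) t = deriv ψ t • w := fun t =>
    deriv_smul_const (hψ.1.differentiable (by simp) t) w
  have e := hv (fun t => ψ t • w) ((hψ.1.of_le (by simp)).smul contDiff_const)
    (by rw [hψ.eq_zero (by simp), zero_smul])
  have e1 : ∫ t in Ioo t₀ t₁, ⟪ι (v t), ι (deriv (fun t => ψ t • w) t)⟫
      = ⟪N.compLpL 2 (tvol t₀ t₁) (i.compLpL 2 (tvol t₀ t₁) v),
        tens t₀ t₁ hψ.deriv.1.continuous (ι w)⟫ := by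
    rw [inner_compLpL_tens]
    refine integral_congr_ae ?_
    filter_upwards [i.coeFn_compLpL v] with t h
    rw [hψd, map_smul, inner_smul_right, h]
    rfl
  have e2 : ∫ t in Ioo t₀ t₁, ⟪(A ∘L i) (v t), ψ t • w⟫
      = ⟪A.compLpL 2 (tvol t₀ t₁) (i.compLpL 2 (tvol t₀ t₁) v),
        tens t₀ t₁ hψ.1.continuous w⟫ := by
    rw [inner_compLpL_tens]
    refine integral_congr_ae ?_
    filter_upwards [i.coeFn_compLpL v] with t h
    rw [inner_smul_right, h]
    rfl
  have e3 : ∀ y : Lp V 2 (tvol t₀ t₁), ∫ t in Ioo t₀ t₁, ⟪y t, ψ t • w⟫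
      = ⟪y, tens t₀ t₁ hψ.1.continuous w⟫ := fun y => by
    rw [inner_tens]
    simp only [inner_smul_right]
  have e4 := hb (ι w) ψ hψ
  rw [e1, e2, e3, inner_sub_left, inner_adjoint_compLpL_tens, map_smul, inner_smul_right,
    inner_sub_left, inner_sub_left] at e
  simp only [map_add, inner_add_left]
  have hι : N (i w) = ι w := rfl
  rw [hι]
  linear_combination e + e4

/-- Well-posedness of the weak problem, with affine dependence on the initial value. -/
theorem exists_solution_map (ht : t₀ < t₁) (hN : Function.Injective (N ∘L i)) {P : X →L[ℝ] V}
    (hP : ∀ x ∈ M, i (P x) = x) (hi : ∀ w, i w ∈ M) {c : ℝ} (hc : 0 < c)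
    (hA : ∀ w, c * ‖w‖ ^ 2 ≤ ⟪A (i w), w⟫) (hS : Dense S) (g : Lp H 2 (tvol t₀ t₁))
    {Tb : Lp X 2 (tvol t₀ t₁)} {G' : Lp H 2 (tvol t₀ t₁)}
    (hTb : ∀ ψ : ℝ → ℝ, IsTest (Ioo t₀ t₁) ψ →
      ∫ t in Ioo t₀ t₁, deriv ψ t • N (Tb t) = - ∫ t in Ioo t₀ t₁, ψ t • G' t) :
    ∃ T W : H → Lp X 2 (tvol t₀ t₁), (∀ π T', IsWeakSol N i A M S g Tb π T' ↔ T' = T π) ∧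
      (∀ δ W', IsWeakSol N i A M S 0 0 δ W' ↔ W' = W δ) ∧
      ∀ π δ (s : ℝ), T (π + s • δ) = T π + s • W δ := by
  have huniq : ∀ (g : Lp H 2 (tvol t₀ t₁)) (Tb : Lp X 2 (tvol t₀ t₁)) (π : H)
      (T T' : Lp X 2 (tvol t₀ t₁)), IsWeakSol N i A M S g Tb π T → IsWeakSol N i A M S g Tb π T' →
      T' = T := fun g Tb π T T' h h' => by
    have h1 := h'.add_smul h (-1)
    simp only [neg_smul, one_smul, add_neg_cancel] at h1
    rw [← sub_eq_zero, sub_eq_add_neg]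
    exact h1.eq_zero ht hN hP hc hA hS
  have h0 : ∀ ψ : ℝ → ℝ, IsTest (Ioo t₀ t₁) ψ →
      ∫ t in Ioo t₀ t₁, deriv ψ t • N ((0 : Lp X 2 (tvol t₀ t₁)) t)
        = - ∫ t in Ioo t₀ t₁, ψ t • (0 : Lp H 2 (tvol t₀ t₁)) t := by
    intro ψ _
    rw [integral_eq_zero_of_ae, integral_eq_zero_of_ae, neg_zero]
    · filter_upwards [Lp.coeFn_zero H 2 (tvol t₀ t₁)] with t h
      rw [h]; simp
    · filter_upwards [Lp.coeFn_zero X 2 (tvol t₀ t₁)] with t h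
      rw [h]; simp
  choose T hT using exists_isWeakSol (N := N) (S := S) ht hi hc hA g hTb
  choose W hW using exists_isWeakSol (N := N) (S := S) ht hi hc hA 0 h0
  refine ⟨T, W, fun π T' => ⟨fun h => huniq _ _ _ _ _ (hT π) h, fun h => h ▸ hT π⟩,
    fun δ W' => ⟨fun h => huniq _ _ _ _ _ (hW δ) h, fun h => h ▸ hW δ⟩, fun π δ s => ?_⟩
  have h := (hT π).add_smul (hW δ) s
  simp only [smul_zero, add_zero] at h
  exact huniq _ _ _ _ _ h (hT _)

end WeakSolution

theorem hasLineDerivAt_prodMk_const {X E F : Type*} [AddCommGroup X] [Module ℝ X]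
    [NormedAddCommGroup E] [NormedSpace ℝ E] [NormedAddCommGroup F] [NormedSpace ℝ F] {f : X → E}
    {w : E} {x v : X} (h : ∀ s : ℝ, f (x + s • v) = f x + s • w) (y : F) :
    HasLineDerivAt ℝ (fun x => (f x, y)) (w, 0) x v := by
  have h1 : HasDerivAt (fun s : ℝ => f (x + s • v)) w 0 := by
    simp only [h]
    simpa using ((hasDerivAt_id (0 : ℝ)).smul_const w).const_add (f x)
  exact h1.prodMk (hasDerivAt_const _ _)

end CFD

namespace CFD
open scoped Topology RealInnerProductSpace NNReal

/-! ### The temperature equation as an abstract weak problem -/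

section Temperature

variable {d : ℕ} {Ω : Set (Pt d)} {t₀ t₁ : ℝ}

/-- The operators of diffusion and advection, from `H¹(Ω)` to the dual of `H¹₀(Ω)`. -/
structure IsTransport (κ : Pt d → ℝ) (u : Vel Ω) (A₁ A₂ : H1 Ω →L[ℝ] H10Space Ω) : Prop where
  diffusion : ∀ (v : H1 Ω) (w : H10Space Ω) (φ : Pt d → ℝ), IsTest Ω φ →
    val (inclL Ω w) =ᵐ[vol Ω] φ → ⟪A₁ v, w⟫ = ∫ x in Ω, κ x * ∑ j, grad v x j * pd j φ x
  advection : ∀ (v : H1 Ω) (w : H10Space Ω) (φ : Pt d → ℝ), IsTest Ω φ →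
    val (inclL Ω w) =ᵐ[vol Ω] φ → ⟪A₂ v, w⟫ = ∫ x in Ω, advect u v x * φ x
  coercive : ∃ c > 0, ∀ w : H10Space Ω, c * ‖w‖ ^ 2 ≤ ⟪A₁ (inclL Ω w) + A₂ (inclL Ω w), w⟫

theorem exists_diffusion (hd : d = 2 ∨ d = 3) (hΩ : IsOpen Ω) (hΩb : Bornology.IsBounded Ω)
    {κ : Pt d → ℝ} (hκ : MemLp κ ⊤ (vol Ω)) {c : ℝ} (hc : 0 < c)
    (hκc : ∀ᵐ x ∂(vol Ω), c ≤ κ x) :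
    ∃ A : H1 Ω →L[ℝ] H10Space Ω, (∀ (v : H1 Ω) (w : H10Space Ω) (φ : Pt d → ℝ), IsTest Ω φ →
      val (inclL Ω w) =ᵐ[vol Ω] φ → ⟪A v, w⟫ = ∫ x in Ω, κ x * ∑ j, grad v x j * pd j φ x) ∧
      ∃ c > 0, ∀ w : H10Space Ω, c * ‖w‖ ^ 2 ≤ ⟪A (inclL Ω w), w⟫ := by
  obtain ⟨M, hM⟩ := exists_mul_clm_top hκ
  obtain ⟨C, hC⟩ := exists_norm_val_le hd hΩ hΩb
  let A : H1 Ω →L[ℝ] H10Space Ω :=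
    ∑ j, ContinuousLinearMap.adjoint (partialL Ω j ∘L inclL Ω) ∘L M ∘L partialL Ω j
  have hA : ∀ v w, ⟪A v, w⟫ = ∑ j, ⟪M (partialL Ω j v), partialL Ω j (inclL Ω w)⟫ := fun v w => by
    simp only [A, sum_apply, sum_inner, ContinuousLinearMap.comp_apply,
      ContinuousLinearMap.adjoint_inner_left]
  have hMv : ∀ v j, M (partialL Ω j v) =ᵐ[vol Ω] fun x => κ x * grad v x j := fun v j => by
    filter_upwards [hM (partialL Ω j v), coeFn_partialL v j] with x h1 h2
    rw [h1, h2]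
  -- By Poincaré, `‖w‖² ≤ (C² + 1) ‖∇w‖²`, whence the coercivity constant.
  refine ⟨A, fun v w φ hφ hw => ?_, c / (C ^ 2 + 1), by positivity, fun w => ?_⟩
  · rw [hA]
    have h1 : ∀ j, ⟪M (partialL Ω j v), partialL Ω j (inclL Ω w)⟫
        = ∫ x in Ω, (κ x * grad v x j) * pd j φ x := fun j =>
      inner_lp_eq_integral_mul (hMv v j)
        ((coeFn_partialL _ j).trans (grad_ae_eq_of_val_ae_eq hΩ hφ hw j))
    have h2 := integral_finsetSum (μ := vol Ω) Finset.univ fun j _ =>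
      ((Lp.memLp (M (partialL Ω j v))).ae_eq (hMv v j)).integrable_mul (hφ.memLp_pd j)
    simp only [Pi.mul_apply] at h2
    simp only [h1]
    rw [← h2]
    refine integral_congr_ae (.of_forall fun x => ?_)
    simp only [Finset.mul_sum, mul_assoc]
  · rw [hA]
    set v := inclL Ω w
    have h1 : ∀ j, c * ‖partialL Ω j v‖ ^ 2 ≤ ⟪M (partialL Ω j v), partialL Ω j v⟫ := by
      intro j
      rw [← real_inner_self_eq_norm_sq, L2.inner_def, L2.inner_def, ← integral_const_mul]
      refine integral_mono_ae ((L2.integrable_inner (𝕜 := ℝ) _ _).const_mul c)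
        (L2.integrable_inner (𝕜 := ℝ) _ _) ?_
      filter_upwards [hκc, hM (partialL Ω j v)] with x h1 h2
      rw [h2]
      simp only [RCLike.inner_apply, conj_trivial]
      nlinarith [mul_self_nonneg (partialL Ω j v x)]
    refine le_trans ?_ (Finset.sum_le_sum fun j _ => h1 j)
    rw [← Finset.mul_sum, ← norm_grad_sq, ← norm_inclL, norm_sq_eq, div_mul_eq_mul_div,
      div_le_iff₀ (by positivity), mul_assoc]
    have h2 := hC v (inclL_mem w)
    have h3 : ‖val v‖ ^ 2 ≤ C ^ 2 * ‖grad v‖ ^ 2 := by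
      rw [← mul_pow]; gcongr
    refine mul_le_mul_of_nonneg_left ?_ hc.le
    show ‖val v‖ ^ 2 + ‖grad v‖ ^ 2 ≤ _
    linarith

/-- The operator is the sum of `Q j† ∂_j`, with `Q j` multiplication by `u j` on `H¹₀`. Skewness is
checked on test functions and extends by continuity and density. -/
theorem exists_advection (hd : d = 2 ∨ d = 3) (hΩ : IsOpen Ω) (hΩb : Bornology.IsBounded Ω)
    {u : Vel Ω} (hu4 : ∀ j, MemLp (val (u j)) 4 (vol Ω))
    (hdiv : ∀ᵐ x ∂(vol Ω), ∑ i, grad (u i) x i = 0) :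
    ∃ A : H1 Ω →L[ℝ] H10Space Ω, (∀ (v : H1 Ω) (w : H10Space Ω) (φ : Pt d → ℝ), IsTest Ω φ →
      val (inclL Ω w) =ᵐ[vol Ω] φ → ⟪A v, w⟫ = ∫ x in Ω, advect u v x * φ x) ∧
      ∀ w : H10Space Ω, ⟪A (inclL Ω w), w⟫ = 0 := by
  choose Q hQ using fun j => exists_mul_clm_four hd hΩ hΩb (hu4 j)
  let A : H1 Ω →L[ℝ] H10Space Ω := ∑ j, ContinuousLinearMap.adjoint (Q j) ∘L partialL Ω j
  have hA : ∀ v w, ⟪A v, w⟫ = ∑ j, ⟪partialL Ω j v, Q j w⟫ := fun v w => by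
    simp only [A, sum_apply, sum_inner, ContinuousLinearMap.comp_apply,
      ContinuousLinearMap.adjoint_inner_left]
  have hQφ : ∀ (w : H10Space Ω) (φ : Pt d → ℝ), val (inclL Ω w) =ᵐ[vol Ω] φ → ∀ j,
      Q j w =ᵐ[vol Ω] fun x => val (u j) x * φ x := fun w φ hw j => by
    filter_upwards [hQ j w, hw] with x h1 h2
    rw [h1, h2]
  refine ⟨A, fun v w φ hφ hw => ?_, fun w => ?_⟩
  · rw [hA]
    have h1 : ∀ j, ⟪partialL Ω j v, Q j w⟫ = ∫ x in Ω, grad v x j * (val (u j) x * φ x) := fun j =>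
      inner_lp_eq_integral_mul (coeFn_partialL v j) (hQφ w φ hw j)
    have h2 := integral_finsetSum (μ := vol Ω) Finset.univ fun j _ =>
      (memLp_coord (grad v) j).integrable_mul ((Lp.memLp (Q j w)).ae_eq (hQφ w φ hw j))
    simp only [Pi.mul_apply] at h2
    simp only [h1]
    rw [← h2]
    refine integral_congr_ae (.of_forall fun x => ?_)
    simp only [advect, Finset.sum_mul]
    exact Finset.sum_congr rfl fun j _ => by ring
  · have hcont : Continuous fun w : H10Space Ω => ⟪A (inclL Ω w), w⟫ :=
      (A.continuous.comp (inclL Ω).continuous).inner continuous_id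
    refine congrFun (hcont.ext_on (dense_test Ω) continuous_const fun w hw => ?_) w
    obtain ⟨φ, hφ, h⟩ := hw
    simp only [hA]
    rw [← integral_advect_self hdiv hφ]
    exact Finset.sum_congr rfl fun j _ => inner_lp_eq_integral_mul
      ((coeFn_partialL _ j).trans (grad_ae_eq_of_val_ae_eq hΩ hφ h j)) (hQφ w φ h j)

theorem exists_isTransport (hd : d = 2 ∨ d = 3) (hΩ : IsOpen Ω) (hΩb : Bornology.IsBounded Ω)
    {D : Data Ω t₀ t₁} (hD : D.Admissible) {u : Vel Ω} {p : Pres Ω} (h : IsFlow D u p) :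
    ∃ A₁ A₂, IsTransport D.κ u A₁ A₂ := by
  obtain ⟨c, hc, hκ⟩ := hD.κ_pos
  obtain ⟨A₁, h1, b, hb, h2⟩ := exists_diffusion hd hΩ hΩb hD.κ_bdd hc hκ
  obtain ⟨A₂, h3, h4⟩ := exists_advection hd hΩ hΩb
    (fun j => memLp_four_of_sub_mem hd hΩ hΩb (h.1 j) (hD.ub_L4 j)) h.2.1
  exact ⟨A₁, A₂, h1, h3, b, hb, fun w => by rw [inner_add_left, h4, add_zero]; exact h2 w⟩

/-- The temperature equation as an abstract weak problem. -/
theorem isTemperature_iff {κ : Pt d → ℝ} {u : Vel Ω} {A₁ A₂ : H1 Ω →L[ℝ] H10Space Ω}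
    (hA : IsTransport κ u A₁ A₂) {g : Lp (Lp ℝ 2 (vol Ω)) 2 (tvol t₀ t₁)} {Tb : Temp Ω t₀ t₁}
    {π : H1 Ω} {T : Temp Ω t₀ t₁} :
    IsTemperature κ u g Tb π T ↔ IsWeakSol (valL Ω) (inclL Ω) (A₁ + A₂) (H10 Ω)
      {w | inclL Ω w ∈ testH1 Ω} g Tb (valL Ω π) T := by
  rw [isWeakSol_add_iff]
  have key : ∀ (w : H10Space Ω) (φ : Pt d → ℝ), val (inclL Ω w) =ᵐ[vol Ω] φ →
      ∀ z : Lp ℝ 2 (vol Ω), ⟪z, val (inclL Ω w)⟫ = ∫ x in Ω, z x * φ x := fun w φ hw z =>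
    inner_lp_eq_integral_mul .rfl hw
  refine and_congr_right fun _ => ⟨fun h w hw ψ hψ => ?_, fun h φ ψ hφ hψ => ?_⟩
  · obtain ⟨φ, hφ, hw⟩ := hw
    have e := h φ ψ hφ hψ
    simp only [key w φ hw, hA.diffusion _ w φ hφ hw, hA.advection _ w φ hφ hw, valL_apply]
    exact e
  -- Every test function is the value of an element of `H¹₀`, so the abstract test set misses none
  -- of them.
  · obtain ⟨v, hv, hvφ, -⟩ := hφ.exists_H1
    obtain ⟨w, rfl⟩ := exists_inclL_eq ((testH1 Ω).le_topologicalClosure hv)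
    have e := h w hv ψ hψ
    simp only [key w φ hvφ, hA.diffusion _ w φ hφ hvφ, hA.advection _ w φ hφ hvφ, valL_apply] at e
    exact e

/-- Well-posedness of the temperature equation, with affine dependence on the initial value. -/
theorem exists_temperature_map (ht : t₀ < t₁) (hΩ : IsOpen Ω) {κ : Pt d → ℝ} {u : Vel Ω}
    {A₁ A₂ : H1 Ω →L[ℝ] H10Space Ω} (hA : IsTransport κ u A₁ A₂)
    (g : Lp (Lp ℝ 2 (vol Ω)) 2 (tvol t₀ t₁)) {Tb : Temp Ω t₀ t₁}
    {G' : Lp (Lp ℝ 2 (vol Ω)) 2 (tvol t₀ t₁)} (hTb : IsWeakTimeDeriv Tb G') :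
    ∃ T W : H1 Ω → Temp Ω t₀ t₁, (∀ π T', IsTemperature κ u g Tb π T' ↔ T' = T π) ∧
      (∀ δ W', IsTemperature κ u 0 0 δ W' ↔ W' = W δ) ∧
      ∀ π δ (s : ℝ), T (π + s • δ) = T π + s • W δ := by
  obtain ⟨c, hc, hco⟩ := hA.coercive
  obtain ⟨P, hP⟩ := exists_proj Ω
  have hinj : Function.Injective (valL Ω ∘L inclL Ω) :=
    (valL_injective hΩ).comp (Subtype.val_injective (p := (· ∈ H10 Ω)))
  obtain ⟨T, W, hT, hW, hTW⟩ := exists_solution_map ht hinj hP inclL_mem hc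
    (A := A₁ + A₂) hco (dense_test Ω) g (N := valL Ω) hTb
  refine ⟨fun π => T (valL Ω π), fun δ => W (valL Ω δ), fun π T' => ?_, fun δ W' => ?_,
    fun π δ s => ?_⟩
  · rw [isTemperature_iff hA, hT]
  · rw [isTemperature_iff hA, hW]
  · exact (congrArg T (by rw [map_add, map_smul])).trans (hTW _ _ s)

end Temperature
end CFD

/-! ### The solution map and its Gateaux derivative -/

theorem mainTheorem4 {d : ℕ} (hd : d = 2 ∨ d = 3) (Ω : Set (CFD.Pt d)) (hΩo : IsOpen Ω)
    (hΩb : Bornology.IsBounded Ω) (hΩc : IsConnected Ω) (t₀ t₁ : ℝ) (ht : t₀ < t₁)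
    (D : CFD.Data Ω t₀ t₁) (hD : D.Admissible)
    (u : CFD.Vel Ω) (p : CFD.Pres Ω) (hup : CFD.IsFlow D u p) :
    ∃ S : CFD.H1 Ω → CFD.State Ω t₀ t₁,
      (∀ (π : CFD.H1 Ω) (z : CFD.State Ω t₀ t₁),
        (CFD.IsCFDSolution D π z ∧ z.2.1 = u) ↔ z = S π) ∧
      ((∀ (u' : CFD.Vel Ω) (p' : CFD.Pres Ω), CFD.IsFlow D u' p' → u' = u) →
        ∀ (π : CFD.H1 Ω) (z : CFD.State Ω t₀ t₁), CFD.IsCFDSolution D π z ↔ z = S π) ∧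
      ∀ π₀ δπ₀ : CFD.H1 Ω, ∃ w : CFD.Temp Ω t₀ t₁,
        (∀ w' : CFD.Temp Ω t₀ t₁,
          CFD.IsTemperature D.κ (S π₀).2.1 0 0 δπ₀ w' ↔ w' = w) ∧
        HasLineDerivAt ℝ S (w, 0, 0) π₀ δπ₀ := by
  obtain ⟨A₁, A₂, hA⟩ := CFD.exists_isTransport hd hΩo hΩb hD hup
  obtain ⟨G', hG'⟩ := hD.Tb_deriv
  obtain ⟨T, W, hT, hW, hTW⟩ := CFD.exists_temperature_map ht hΩo hA D.gT hG'
  -- Fixing the velocity fixes the pressure by `pressure_unique` and the temperature by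
  -- well-posedness, so a state with velocity `u` has no freedom left.
  have hS : ∀ (π : CFD.H1 Ω) (z : CFD.State Ω t₀ t₁),
      (CFD.IsCFDSolution D π z ∧ z.2.1 = u) ↔ z = (T π, u, p) := by
    rintro π ⟨T', u', p'⟩
    constructor
    · rintro ⟨⟨h1, h2⟩, h3⟩
      obtain rfl : u' = u := h3
      rw [(hT π T').1 h2, show p' = p from h1.pressure_unique hΩo hΩb hΩc hup]
    · rintro ⟨⟩
      exact ⟨⟨hup, (hT π _).2 rfl⟩, rfl⟩
  refine ⟨fun π => (T π, u, p), hS, fun hu π z => ?_, fun π₀ δ => ⟨W δ, hW δ, ?_⟩⟩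
  · rw [← hS]
    exact ⟨fun h => ⟨h, hu _ _ h.1⟩, fun h => h.1⟩
  · exact CFD.hasLineDerivAt_prodMk_const (hTW π₀ δ) (u, p)
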